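/- Let three points $\vec r_i=(x_i,y_i)$, $i=1,2,3$ (indices modulo $3$), move on the plane so that the velocity of each point is always aligned with the line joining it to the next one (Rule A). On the configuration space $M=\mathbb R^6$ with coordinates $(x_1,y_1,x_2,y_2,x_3,y_3)$ let $$Z_i=(x_{i+1}-x_i)\,\partial_{x_i}+(y_{i+1}-y_i)\,\partial_{y_i},\qquad i=1,2,3,$$ and let $\mathcal D=\mathrm{Span}(Z_1,Z_2,Z_3)$ be the velocity distribution, $\mathcal D_q=\mathrm{Span}_{\mathbb R}(Z_1(q),Z_2(q),Z_3(q))\subset T_qM$. (1) $\mathcal D$ has growth vector $(3,6)$ at $q\in M$, i.e. $\mathcal D_q$ has dimension $3$ and $\mathcal D+[\mathcal D,\mathcal D]$ has dimension $6$ at $q$, if and only if the three points $\vec r_1,\vec r_2,\vec r_3$ are not collinear. (2) Let $U\subseteq M$ be a nonempty connected open set. The Lie algebra of all symmetries of $\mathcal D$ on $U$, i.e. of all smooth ($C^\infty$) vector fields $X$ on $U$ such that $[X,Y]$ is a section of $\mathcal D$ over $U$ for every smooth section $Y$ of $\mathcal D$ over $U$, is isomorphic to $\mathfrak{sl}(3,\mathbb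 R)$. It has dimension $8$ and the restrictions to $U$ of the following linearly independent vector fields form a basis of it: $$\begin{aligned} X_1&=\sum_{i=1}^3\partial_{x_i},& X_2&=\sum_{i=1}^3\partial_{y_i},& X_3&=\sum_{i=1}^3 y_i\,\partial_{x_i},& X_4&=\sum_{i=1}^3 x_i\,\partial_{y_i},\\ X_5&=\sum_{i=1}^3 x_i\,\partial_{x_i},& X_6&=\sum_{i=1}^3 y_i\,\partial_{y_i},& X_7&=\sum_{i=1}^3\bigl(x_iy_i\,\partial_{x_i}+y_i^2\,\partial_{y_i}\bigr),& X_8&=\sum_{i=1}^3\bigl(x_i^2\,\partial_{x_i}+x_iy_i\,\partial_{y_i}\bigr). \end{aligned}$$ -/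

import Mathlib

open scoped ContDiff

namespace ThreeAnts

section Distributions

variable {E : Type*} [NormedAddCommGroup E] [NormedSpace ℝ E]

/-- `Y` is a smooth section over the open set `U` of the field of tangent subspaces `D`: it is
smooth on `U` and `Y q ∈ D q` for all `q ∈ U`. Its values outside `U` are irrelevant. -/
def IsSectionOn (D : E → Submodule ℝ E) (U : TopologicalSpace.Opens E) (Y : E → E) : Prop :=
  ContDiffOn ℝ ∞ Y U ∧ ∀ q ∈ U, Y q ∈ D q

/-- The derived field of subspaces `[D, D] + D`: at `q` it is spanned by `D q` and the values at `q`
of the Lie brackets of smooth sections of `D` defined near `q`. -/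
def derivedField (D : E → Submodule ℝ E) (q : E) : Submodule ℝ E :=
  D q ⊔ Submodule.span ℝ
    {w | ∃ V : TopologicalSpace.Opens E, q ∈ V ∧ ∃ Y W : E → E,
      IsSectionOn D V Y ∧ IsSectionOn D V W ∧ w = VectorField.lieBracket ℝ Y W q}

/-- The derived flag `D⁰ = D`, `Dᴵ⁺¹ = [Dᴵ, Dᴵ] + Dᴵ`. -/
def derivedFlag (D : E → Submodule ℝ E) : ℕ → E → Submodule ℝ E
  | 0 => D
  | I + 1 => derivedField (derivedFlag D I)

/-- `D` has growth vector `r` at `q`: the ranks at `q` of `D⁰, D¹, …` are the entries of `r`, and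
they stay equal to the last entry from there on. -/
def HasGrowthVectorAt (D : E → Submodule ℝ E) (q : E) (r : List ℕ) : Prop :=
  ∀ I : ℕ, Module.finrank ℝ (derivedFlag D I q) = r.getD I (r.getLastD 0)

/-- The real vector space of smooth vector fields on the open set `U`. A vector field on `U` is
stored as its extension by zero to the whole space, so that equality is equality on `U`. -/
def smoothFields (U : TopologicalSpace.Opens E) : Submodule ℝ (E → E) where
  carrier := {X | ContDiffOn ℝ ∞ X U ∧ ∀ q ∉ U, X q = 0}
  add_mem' := fun {X Y} hX hY =>
    ⟨hX.1.add hY.1, fun q hq => by simp [hX.2 q hq, hY.2 q hq]⟩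
  zero_mem' := ⟨contDiffOn_const, fun _ _ => rfl⟩
  smul_mem' := fun c X hX =>
    ⟨contDiffOn_const.smul hX.1, fun q hq => by simp [hX.2 q hq]⟩

variable {U : TopologicalSpace.Opens E}

theorem smoothFields_contDiffAt {X : E → E} (hX : ContDiffOn ℝ ∞ X U) {q : E} (hq : q ∈ U) :
    ContDiffAt ℝ ∞ X q :=
  hX.contDiffAt (U.isOpen.mem_nhds hq)

theorem smoothFields_differentiableAt {X : E → E} (hX : ContDiffOn ℝ ∞ X U) {q : E}
    (hq : q ∈ U) : DifferentiableAt ℝ X q :=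
  (smoothFields_contDiffAt hX hq).differentiableAt (by simp)

theorem contDiffOn_lieBracket {X Y : E → E} (hX : ContDiffOn ℝ ∞ X U)
    (hY : ContDiffOn ℝ ∞ Y U) : ContDiffOn ℝ ∞ (VectorField.lieBracket ℝ X Y) U := fun _ hq =>
  (ContDiffAt.lieBracket_vectorField (smoothFields_contDiffAt hX hq)
    (smoothFields_contDiffAt hY hq) (by simp)).contDiffWithinAt

/-- The Lie bracket of vector fields on `U`. -/
noncomputable instance : Bracket (smoothFields U) (smoothFields U) where
  bracket X Y := ⟨(U : Set E).indicator (VectorField.lieBracket ℝ X.1 Y.1),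
    (contDiffOn_lieBracket X.2.1 Y.2.1).congr fun _ hq => Set.indicator_of_mem hq _,
    fun _ hq => Set.indicator_of_notMem hq _⟩

theorem bracket_apply (X Y : smoothFields U) {q : E} (hq : q ∈ U) :
    (⁅X, Y⁆ : smoothFields U).1 q = VectorField.lieBracket ℝ X.1 Y.1 q :=
  Set.indicator_of_mem (s := (U : Set E)) hq _

theorem smoothFields_ext {X Y : smoothFields U} (h : ∀ q ∈ U, X.1 q = Y.1 q) : X = Y := by
  apply Subtype.ext
  funext q
  by_cases hq : q ∈ U
  · exact h q hq
  · rw [X.2.2 q hq, Y.2.2 q hq]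

theorem bracket_eventuallyEq (X Y : smoothFields U) {q : E} (hq : q ∈ U) :
    (⁅X, Y⁆ : smoothFields U).1 =ᶠ[nhds q] VectorField.lieBracket ℝ X.1 Y.1 := by
  filter_upwards [U.isOpen.mem_nhds hq] with p hp using bracket_apply X Y hp

theorem minSmoothness_le : minSmoothness ℝ 2 ≤ (∞ : WithTop ℕ∞) := by
  rw [minSmoothness_of_isRCLikeNormedField]
  exact WithTop.coe_le_coe.2 (le_top : (2 : ℕ∞) ≤ ⊤)

noncomputable instance : LieRing (smoothFields U) where
  add_lie X Y Z := smoothFields_ext fun q hq => by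
    change _ = (⁅X, Z⁆ : smoothFields U).1 q + (⁅Y, Z⁆ : smoothFields U).1 q
    rw [bracket_apply _ _ hq, bracket_apply _ _ hq, bracket_apply _ _ hq]
    exact VectorField.lieBracket_add_left (smoothFields_differentiableAt X.2.1 hq)
      (smoothFields_differentiableAt Y.2.1 hq)
  lie_add X Y Z := smoothFields_ext fun q hq => by
    change _ = (⁅X, Y⁆ : smoothFields U).1 q + (⁅X, Z⁆ : smoothFields U).1 q
    rw [bracket_apply _ _ hq, bracket_apply _ _ hq, bracket_apply _ _ hq]
    exact VectorField.lieBracket_add_right (smoothFields_differentiableAt Y.2.1 hq)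
      (smoothFields_differentiableAt Z.2.1 hq)
  lie_self X := smoothFields_ext fun q hq => by
    rw [bracket_apply _ _ hq, VectorField.lieBracket_self]
    rfl
  leibniz_lie X Y Z := smoothFields_ext fun q hq => by
    change _ = (⁅⁅X, Y⁆, Z⁆ : smoothFields U).1 q + (⁅Y, ⁅X, Z⁆⁆ : smoothFields U).1 q
    rw [bracket_apply _ _ hq, bracket_apply _ _ hq, bracket_apply _ _ hq,
      (Filter.EventuallyEq.refl _ X.1).lieBracket_vectorField_eq (bracket_eventuallyEq Y Z hq),
      (bracket_eventuallyEq X Y hq).lieBracket_vectorField_eq (Filter.EventuallyEq.refl _ Z.1),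
      (Filter.EventuallyEq.refl _ Y.1).lieBracket_vectorField_eq (bracket_eventuallyEq X Z hq)]
    exact VectorField.leibniz_identity_lieBracket minSmoothness_le
      (smoothFields_contDiffAt X.2.1 hq) (smoothFields_contDiffAt Y.2.1 hq)
      (smoothFields_contDiffAt Z.2.1 hq)

noncomputable instance : LieAlgebra ℝ (smoothFields U) where
  lie_smul c X Y := smoothFields_ext fun q hq => by
    change _ = c • (⁅X, Y⁆ : smoothFields U).1 q
    rw [bracket_apply _ _ hq, bracket_apply _ _ hq]
    exact VectorField.lieBracket_const_smul_right (smoothFields_differentiableAt Y.2.1 hq)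

/-- The vector field on `U` obtained by restricting a smooth vector field on the whole space. -/
noncomputable def restrictField (U : TopologicalSpace.Opens E) (V : E → E)
    (hV : ContDiff ℝ ∞ V) : smoothFields U :=
  ⟨(U : Set E).indicator V, hV.contDiffOn.congr fun _ hq => Set.indicator_of_mem hq _,
    fun _ hq => Set.indicator_of_notMem hq _⟩

/-- The Lie algebra of symmetries of `D` on `U`: the smooth vector fields `X` on `U` such that
`[X, Y]` is a section of `D` whenever `Y` is, that is, `[X, D] ⊂ D`. -/
noncomputable def symmetryAlgebra (D : E → Submodule ℝ E) (U : TopologicalSpace.Opens E) :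
    LieSubalgebra ℝ (smoothFields U) where
  carrier := {X | ∀ Y : E → E, IsSectionOn D U Y →
    IsSectionOn D U (VectorField.lieBracket ℝ X.1 Y)}
  add_mem' := fun {X X'} hX hX' Y hY =>
    ⟨contDiffOn_lieBracket (X + X').2.1 hY.1, fun q hq => by
      have h := VectorField.lieBracket_add_left (W := Y) (smoothFields_differentiableAt X.2.1 hq)
        (smoothFields_differentiableAt X'.2.1 hq)
      change VectorField.lieBracket ℝ (X.1 + X'.1) Y q ∈ D q
      rw [h]
      exact (D q).add_mem ((hX Y hY).2 q hq) ((hX' Y hY).2 q hq)⟩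
  zero_mem' := fun Y hY =>
    ⟨contDiffOn_lieBracket (0 : smoothFields U).2.1 hY.1, fun q _ => by
      change VectorField.lieBracket ℝ (0 : E → E) Y q ∈ D q
      rw [VectorField.lieBracket_zero_left]
      exact (D q).zero_mem⟩
  smul_mem' := fun c X hX Y hY =>
    ⟨contDiffOn_lieBracket (c • X).2.1 hY.1, fun q hq => by
      have h := VectorField.lieBracket_const_smul_left (W := Y) (c := c)
        (smoothFields_differentiableAt X.2.1 hq)
      change VectorField.lieBracket ℝ (c • X.1) Y q ∈ D q
      rw [h]
      exact (D q).smul_mem c ((hX Y hY).2 q hq)⟩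
  lie_mem' := fun {X X'} hX hX' Y hY =>
    ⟨contDiffOn_lieBracket (⁅X, X'⁆ : smoothFields U).2.1 hY.1, fun q hq => by
      have h := VectorField.leibniz_identity_lieBracket (𝕜 := ℝ) minSmoothness_le
        (smoothFields_contDiffAt X.2.1 hq) (smoothFields_contDiffAt X'.2.1 hq)
        (smoothFields_contDiffAt hY.1 hq)
      rw [(bracket_eventuallyEq X X' hq).lieBracket_vectorField_eq (Filter.EventuallyEq.refl _ Y),
        ← sub_eq_of_eq_add h]
      exact (D q).sub_mem ((hX _ (hX' Y hY)).2 q hq) ((hX' _ (hX Y hY)).2 q hq)⟩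

end Distributions

/-- A configuration of three ants on the plane: `q i = (xᵢ, yᵢ)`. Indices in `Fin 3` are added
modulo `3`. Tangent vectors `∑ᵢ (aᵢ ∂_{xᵢ} + bᵢ ∂_{yᵢ})` are elements `fun i => (aᵢ, bᵢ)`. -/
abbrev Config : Type := Fin 3 → ℝ × ℝ

/-- `Zᵢ = (xᵢ₊₁ - xᵢ) ∂_{xᵢ} + (yᵢ₊₁ - yᵢ) ∂_{yᵢ}`. -/
def chaseField (i : Fin 3) (q : Config) : Config :=
  Pi.single i ((q (i + 1)).1 - (q i).1, (q (i + 1)).2 - (q i).2)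

/-- The velocity distribution of three ants, each moving towards or away from the next one:
`D_q = Span (Z₁, Z₂, Z₃)`. -/
def velocityDistribution (q : Config) : Submodule ℝ Config :=
  Submodule.span ℝ (Set.range fun i => chaseField i q)

/-- The eight vector fields `X₁, …, X₈`, numbered from `0`; the entries are the coefficients of
`∂_{xᵢ}` and `∂_{yᵢ}`. -/
def projectiveField (k : Fin 8) (q : Config) : Config := fun i =>
  let x := (q i).1
  let y := (q i).2
  match k with
  | 0 => (1, 0)
  | 1 => (0, 1)
  | 2 => (y, 0)
  | 3 => (0, x)
  | 4 => (x, 0)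
  | 5 => (0, y)
  | 6 => (x * y, y ^ 2)
  | 7 => (x ^ 2, x * y)

theorem contDiff_projectiveField (k : Fin 8) : ContDiff ℝ ∞ (projectiveField k) := by
  rw [contDiff_pi]
  intro i
  fin_cases k <;> simp only [projectiveField] <;> fun_prop

end ThreeAnts

/-! Growth vector. `Zᵢ` moves only the point `i`, along `edge i`, and `[Zᵢ, Zᵢ₊₁]` moves the same
point along `-edge (i + 1)`. For nonzero area these two edges form a basis of the plane, so three
fields and three brackets span everything. If the area is zero and the rank is 3, the covector `w ↦
cross (w 0) (edge 0 q)` is nonzero and kills the whole derived space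
(`derivedField_ne_top_of_area_eq_zero`).

Projective fields are symmetries because projective maps preserve lines (`lieBracket_homField_mem`).
The substance is the converse. Lift each point to a homogeneous vector `vᵢ = (xᵢ, yᵢ, 1)`. On
functions of degree `lᵢ` in each `vᵢ`, the operator `vᵢ₊₁ · ∂/∂vᵢ` becomes `Zᵢ + lᵢ`. These
operators satisfy the relations of root vectors of `sl(3)` (`isKillingTriple`), and for the
components `Xᵢ` of a symmetry the areas `φᵢ = cross Xᵢ (edge i)`, of degree 2 in `vᵢ` and 1 in
`vᵢ₊₁`, satisfy equations `Eᵢ uⱼ + Eⱼ uᵢ = 0` with `uᵢ = φᵢ₊₁`. Purely algebraic consequences of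
these relations (`IsKillingTriple.third_order`, `IsKillingTriple.sum_eq_zero`) show that the system
is of finite type: `φ`, `ψ`, `χ` have derivatives along the `Zᵢ` that are constant combinations of
themselves (`ChaseKilling.closed`).

Divided by the area, these functions are the entries of a matrix `β` in the moving frame `g = (v₀ v₁
v₂)`. The closed system says exactly that `g β g⁻¹` is annihilated by every `Zᵢ`
(`ChaseSymmetry.exists_constant_matrix`), hence by their brackets, hence is locally constant where
the area is nonzero. So a symmetry is locally projective there. Projective fields have quadratic
components, so the third derivatives of the difference from one such field vanish on a dense set,
and therefore throughout `U`; connectedness makes the matrix global (`exists_eq_homField`). Scalar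
matrices give the zero field, which leaves `sl(3)`. -/

namespace ThreeAnts

/-! ### Signed areas and the growth vector. -/

/-- The signed area spanned by two plane vectors. -/
def cross (a b : ℝ × ℝ) : ℝ := a.1 * b.2 - a.2 * b.1

/-- The difference `rᵢ₊₁ - rᵢ`. -/
def edge (i : Fin 3) (q : Config) : ℝ × ℝ := q (i + 1) - q i

/-- Twice the signed area of the triangle `r₀ r₁ r₂`. -/
def area (q : Config) : ℝ := cross (edge 0 q) (edge 1 q)

theorem chaseField_eq (i : Fin 3) (q : Config) : chaseField i q = Pi.single i (edge i q) := rfl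

theorem cross_edge_edge (i : Fin 3) (q : Config) :
    cross (edge i q) (edge (i + 1) q) = area q := by
  fin_cases i <;> simp [area, cross, edge] <;> ring

theorem exists_smul_of_cross_eq_zero {a v : ℝ × ℝ} (hv : v ≠ 0) (h : cross a v = 0) :
    ∃ c : ℝ, a = c • v := by
  obtain ⟨v1, v2⟩ := v
  obtain ⟨a1, a2⟩ := a
  simp only [cross] at h
  by_cases h1 : v1 = 0
  · have h2 : v2 ≠ 0 := fun h2 => hv (by simp [h1, h2])
    refine ⟨a2 / v2, ?_⟩
    subst h1
    have : a1 = 0 := by simpa [h2] using h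
    ext <;> simp [this, h2]
  · refine ⟨a1 / v1, ?_⟩
    ext
    · simp [h1]
    · simp only [Prod.smul_mk, smul_eq_mul]
      field_simp
      linarith

theorem mem_velocityDistribution_iff {q w : Config} :
    w ∈ velocityDistribution q ↔ ∀ i, ∃ c : ℝ, w i = c • edge i q := by
  rw [velocityDistribution, Submodule.mem_span_range_iff_exists_fun]
  have hsum : ∀ (c : Fin 3 → ℝ) (i : Fin 3),
      (∑ j, c j • chaseField j q) i = c i • edge i q := by
    intro c i
    rw [Finset.sum_apply, Finset.sum_eq_single i]
    · simp [chaseField_eq]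
    · intro j _ hj
      simp [chaseField_eq, Pi.single_eq_of_ne hj.symm]
    · simp
  constructor
  · rintro ⟨c, rfl⟩ i
    exact ⟨c i, hsum c i⟩
  · intro h
    choose c hc using h
    exact ⟨c, funext fun i => (hsum c i).trans (hc i).symm⟩

theorem cross_eq_zero_of_mem {q w : Config} (h : w ∈ velocityDistribution q) (i : Fin 3) :
    cross (w i) (edge i q) = 0 := by
  obtain ⟨c, hc⟩ := mem_velocityDistribution_iff.1 h i
  rw [hc]
  simp [cross]
  ring

/-- The linear map `q ↦ Zᵢ(q)`. -/
noncomputable def chaseMap (i : Fin 3) : Config →L[ℝ] Config :=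
  (ContinuousLinearMap.single ℝ (fun _ : Fin 3 => ℝ × ℝ) i).comp
    (ContinuousLinearMap.proj (R := ℝ) (φ := fun _ : Fin 3 => ℝ × ℝ) (i + 1) -
      ContinuousLinearMap.proj (R := ℝ) (φ := fun _ : Fin 3 => ℝ × ℝ) i)

theorem chaseMap_apply (i : Fin 3) (q : Config) : chaseMap i q = chaseField i q := rfl

theorem coe_chaseMap (i : Fin 3) : ⇑(chaseMap i) = chaseField i := rfl

theorem chaseField_isSectionOn (i : Fin 3) (U : TopologicalSpace.Opens Config) :
    IsSectionOn velocityDistribution U (chaseField i) :=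
  ⟨(chaseMap i).contDiff.contDiffOn, fun _ _ => Submodule.subset_span ⟨i, rfl⟩⟩

theorem lieBracket_chaseField (i j : Fin 3) (q : Config) :
    VectorField.lieBracket ℝ (chaseField i) (chaseField j) q =
      chaseField j (chaseField i q) - chaseField i (chaseField j q) := by
  rw [VectorField.lieBracket, ← coe_chaseMap, ← coe_chaseMap, ContinuousLinearMap.fderiv,
    ContinuousLinearMap.fderiv]

/-- The linear vector field `Wᵢ = [Zᵢ, Zᵢ₊₁]`, whose only component is `-edge (i + 1)` at `i`. -/
def crossField (i : Fin 3) (q : Config) : Config := Pi.single i (-edge (i + 1) q)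

theorem chaseField_commutator (i : Fin 3) (q : Config) :
    chaseField (i + 1) (chaseField i q) - chaseField i (chaseField (i + 1) q) =
      crossField i q := by
  funext j
  fin_cases i <;> fin_cases j <;> simp [chaseField, crossField, edge] <;> rfl

theorem lieBracket_chaseField_succ (i : Fin 3) (q : Config) :
    VectorField.lieBracket ℝ (chaseField i) (chaseField (i + 1)) q = crossField i q := by
  rw [lieBracket_chaseField, chaseField_commutator]

theorem cross_smul_expansion (a v w : ℝ × ℝ) :
    cross v w • a = cross a w • v - cross a v • w := by
  ext <;> simp [cross] <;> ring

/-- Cramer's rule in the basis `edge i q`, `edge (i + 1) q` of the plane; its determinant is the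
area for every `i`. -/
theorem single_eq_of_area_ne_zero {q : Config} (hq : area q ≠ 0) (i : Fin 3) (a : ℝ × ℝ) :
    (Pi.single i a : Config) = (cross a (edge (i + 1) q) / area q) • chaseField i q +
      (cross a (edge i q) / area q) • crossField i q := by
  have h := cross_smul_expansion a (edge i q) (edge (i + 1) q)
  rw [cross_edge_edge] at h
  have h' : a = (area q)⁻¹ • area q • a := (inv_smul_smul₀ hq a).symm
  rw [chaseField_eq, crossField, ← Pi.single_smul, ← Pi.single_smul, ← Pi.single_add]
  congr 1
  conv_lhs => rw [h', h]
  rw [smul_sub, smul_smul, smul_smul, smul_neg, ← sub_eq_add_neg, div_eq_inv_mul, div_eq_inv_mul]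

theorem edge_ne_zero_of_area_ne_zero {q : Config} (hq : area q ≠ 0) (i : Fin 3) :
    edge i q ≠ 0 := by
  intro h
  apply hq
  rw [← cross_edge_edge i, h]
  simp [cross]

theorem span_chaseField_crossField {q : Config} (hq : area q ≠ 0) {S : Submodule ℝ Config}
    (h1 : ∀ i, chaseField i q ∈ S) (h2 : ∀ i, crossField i q ∈ S) : S = ⊤ := by
  rw [eq_top_iff]
  intro w _
  rw [← Finset.univ_sum_single w]
  refine S.sum_mem fun i _ => ?_
  rw [single_eq_of_area_ne_zero hq]
  exact S.add_mem (S.smul_mem _ (h1 i)) (S.smul_mem _ (h2 i))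

theorem collinear_iff_area_eq_zero (q : Config) :
    Collinear ℝ (Set.range q) ↔ area q = 0 := by
  rw [collinear_iff_of_mem (p₀ := q 0) (Set.mem_range_self 0)]
  constructor
  · rintro ⟨v, hv⟩
    obtain ⟨r, hr⟩ := hv (q 1) ⟨1, rfl⟩
    obtain ⟨s, hs⟩ := hv (q 2) ⟨2, rfl⟩
    simp [area, cross, edge, hr, hs]
    ring
  · intro h
    by_cases h0 : edge 0 q = 0
    · refine ⟨q 2 - q 0, ?_⟩
      rintro _ ⟨i, rfl⟩
      fin_cases i
      · exact ⟨0, by simp⟩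
      · exact ⟨0, by simpa [edge, sub_eq_zero] using h0⟩
      · exact ⟨1, by simp⟩
    · refine ⟨edge 0 q, ?_⟩
      have h' : cross (edge 1 q) (edge 0 q) = 0 := by
        simp only [area, cross] at h ⊢
        linarith
      obtain ⟨c, hc⟩ := exists_smul_of_cross_eq_zero h0 h'
      rintro _ ⟨i, rfl⟩
      fin_cases i
      · exact ⟨0, by simp⟩
      · exact ⟨1, by simp [edge]⟩
      · refine ⟨c + 1, ?_⟩
        rw [add_smul, ← hc]
        simp [edge]

theorem le_derivedField {E : Type*} [NormedAddCommGroup E] [NormedSpace ℝ E]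
    (D : E → Submodule ℝ E) (q : E) : D q ≤ derivedField D q := le_sup_left

theorem derivedField_velocity_eq_top {q : Config} (hq : area q ≠ 0) :
    derivedField velocityDistribution q = ⊤ := by
  refine span_chaseField_crossField hq
    (fun i => le_derivedField _ _ (Submodule.subset_span ⟨i, rfl⟩)) fun i => ?_
  refine Submodule.mem_sup_right (Submodule.subset_span ?_)
  exact ⟨⊤, trivial, _, _, chaseField_isSectionOn i ⊤, chaseField_isSectionOn (i + 1) ⊤,
    (lieBracket_chaseField_succ i q).symm⟩

theorem derivedFlag_succ_eq_top {q : Config} (hq : area q ≠ 0) (I : ℕ) :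
    derivedFlag velocityDistribution (I + 1) q = ⊤ := by
  induction I with
  | zero => exact derivedField_velocity_eq_top hq
  | succ I ih =>
    rw [eq_top_iff, ← ih]
    exact le_derivedField _ q

theorem finrank_velocityDistribution {q : Config} (hq : ∀ i, edge i q ≠ 0) :
    Module.finrank ℝ (velocityDistribution q) = 3 := by
  have h : LinearIndependent ℝ fun i => chaseField i q := by
    rw [Fintype.linearIndependent_iff]
    intro c hc i
    have := congrFun hc i
    rw [Finset.sum_apply, Finset.sum_eq_single i] at this
    · simpa [chaseField_eq, hq i] using this
    · intro j _ hj
      simp [chaseField_eq, Pi.single_eq_of_ne hj.symm]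
    · simp
  rw [velocityDistribution, finrank_span_eq_card h, Fintype.card_fin]

theorem edge_ne_zero_of_finrank {q : Config}
    (h : Module.finrank ℝ (velocityDistribution q) = 3) (i : Fin 3) : edge i q ≠ 0 := by
  have hli : LinearIndependent ℝ fun i => chaseField i q := by
    rw [linearIndependent_iff_card_eq_finrank_span, Fintype.card_fin]
    exact h.symm
  intro h0
  apply hli.ne_zero i
  simp [chaseField_eq, h0]

theorem finrank_config : Module.finrank ℝ Config = 6 := by
  simp [Config, Module.finrank_pi_fintype]

/-- Differentiating `cross (Yᵢ) (edge i) = 0` along a tangent vector. -/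
theorem cross_fderiv_section {U : TopologicalSpace.Opens Config} {Y : Config → Config}
    (hY : IsSectionOn velocityDistribution U Y) {q : Config} (hq : q ∈ U) (w : Config)
    (i : Fin 3) :
    cross (fderiv ℝ Y q w i) (edge i q) + cross (Y q i) (edge i w) = 0 := by
  have hd := smoothFields_differentiableAt hY.1 hq
  have hYi : HasFDerivAt (fun p => Y p i)
      ((ContinuousLinearMap.proj (R := ℝ) (φ := fun _ : Fin 3 => ℝ × ℝ) i).comp
        (fderiv ℝ Y q)) q := (hasFDerivAt_pi'.1 hd.hasFDerivAt) i
  have hpi : ∀ j : Fin 3, HasFDerivAt (fun p : Config => p j)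
      (ContinuousLinearMap.proj (R := ℝ) (φ := fun _ : Fin 3 => ℝ × ℝ) j) q :=
    fun j => hasFDerivAt_apply j q
  have he := (hpi (i + 1)).sub (hpi i)
  have key := (hYi.fst.mul he.snd).sub (hYi.snd.mul he.fst)
  have h0 : (fun p => (Y p i).1 * (p (i + 1) - p i).2 - (Y p i).2 * (p (i + 1) - p i).1)
      =ᶠ[nhds q] fun _ => (0 : ℝ) := by
    filter_upwards [U.isOpen.mem_nhds hq] with p hp
    exact cross_eq_zero_of_mem (hY.2 p hp) i
  have := congrArg (fun L => L w)
    (key.unique ((hasFDerivAt_const (0 : ℝ) q).congr_of_eventuallyEq h0))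
  simp at this
  simp only [cross, edge, Prod.fst_sub, Prod.snd_sub]
  linarith

/-- The nonzero covector `w ↦ cross (w 0) (edge 0 q)` kills the derived space. For a bracket,
differentiate `cross (Y 0) (edge 0) = 0` along the other section `W`: the correction term `cross (Y
0) (edge 0 W)` vanishes because `edge 0` of a vector of the distribution combines edges 0 and 1,
which have zero cross product here. -/
theorem derivedField_ne_top_of_area_eq_zero {q : Config} (hq : area q = 0)
    (h0 : edge 0 q ≠ 0) : derivedField velocityDistribution q ≠ ⊤ := by
  intro htop
  let S : Submodule ℝ Config :=
    { carrier := {w | cross (w 0) (edge 0 q) = 0}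
      add_mem' := fun {a b} ha hb => by
        simp only [cross, Set.mem_ofPred_eq, Pi.add_apply, Prod.fst_add, Prod.snd_add] at *
        linarith
      zero_mem' := by simp [cross]
      smul_mem' := fun c a ha => by
        simp only [cross, Set.mem_ofPred_eq, Pi.smul_apply, Prod.smul_fst, Prod.smul_snd,
          smul_eq_mul] at *
        linear_combination c * ha }
  have hvel : ∀ a b : Config, a ∈ velocityDistribution q → b ∈ velocityDistribution q →
      cross (a 0) (edge 0 b) = 0 := by
    intro a b ha hb
    obtain ⟨c, hc⟩ := mem_velocityDistribution_iff.1 ha 0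
    obtain ⟨d, hd⟩ := mem_velocityDistribution_iff.1 hb 0
    obtain ⟨e, he⟩ := mem_velocityDistribution_iff.1 hb 1
    have : edge 0 b = e • edge 1 q - d • edge 0 q := by
      rw [← hd, ← he]; rfl
    rw [hc, this]
    simp only [area, cross, Prod.smul_fst, Prod.smul_snd, Prod.fst_sub, Prod.snd_sub,
      smul_eq_mul] at *
    linear_combination c * e * hq
  have hle : derivedField velocityDistribution q ≤ S := by
    refine sup_le (fun w hw => cross_eq_zero_of_mem hw 0) (Submodule.span_le.2 ?_)
    rintro w ⟨V, hV, Y, W, hY, hW, rfl⟩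
    have e1 := cross_fderiv_section hW hV (Y q) 0
    have e2 := cross_fderiv_section hY hV (W q) 0
    rw [hvel _ _ (hW.2 q hV) (hY.2 q hV), add_zero] at e1
    rw [hvel _ _ (hY.2 q hV) (hW.2 q hV), add_zero] at e2
    change cross (VectorField.lieBracket ℝ Y W q 0) (edge 0 q) = 0
    rw [VectorField.lieBracket]
    simp only [cross, Pi.sub_apply, Prod.fst_sub, Prod.snd_sub] at *
    linarith
  rw [htop] at hle
  have m1 : cross ((1 : ℝ), (0 : ℝ)) (edge 0 q) = 0 :=
    hle (Submodule.mem_top (x := fun _ => ((1 : ℝ), (0 : ℝ))))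
  have m2 : cross ((0 : ℝ), (1 : ℝ)) (edge 0 q) = 0 :=
    hle (Submodule.mem_top (x := fun _ => ((0 : ℝ), (1 : ℝ))))
  simp [cross] at m1 m2
  exact h0 (Prod.ext m2 m1)

theorem hasGrowthVectorAt_iff (q : Config) :
    HasGrowthVectorAt velocityDistribution q [3, 6] ↔ ¬ Collinear ℝ (Set.range q) := by
  rw [collinear_iff_area_eq_zero]
  constructor
  · intro h hq
    have h0 : Module.finrank ℝ (velocityDistribution q) = 3 := h 0
    have h1 : Module.finrank ℝ (derivedField velocityDistribution q) = 6 := h 1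
    -- The first entry 3 of the growth vector excludes coincident consecutive points, so the
    -- covector above is nonzero.
    refine derivedField_ne_top_of_area_eq_zero hq (edge_ne_zero_of_finrank h0 0) ?_
    exact Submodule.eq_top_of_finrank_eq (h1.trans finrank_config.symm)
  · intro hq I
    match I with
    | 0 => exact finrank_velocityDistribution (edge_ne_zero_of_area_ne_zero hq)
    | 1 =>
      rw [derivedFlag_succ_eq_top hq, finrank_top, finrank_config]
      rfl
    -- Beyond the end of the list the expected rank defaults to its last entry, 6.
    | I + 2 =>
      rw [derivedFlag_succ_eq_top hq, finrank_top, finrank_config]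
      rfl

/-! ### Killing-type equations for root vectors of `sl(3)`. -/

section RaisingOperators

variable {V : Type*} [AddCommGroup V] [Module ℝ V]

/-- Prolongation by pure algebra: the Serre relations and the triple commutators, applied to the
`uⱼ`, give linear equations between third-order words, and the Killing equations identify enough of
the words to solve them. The second-order vanishing needs one further pass with weights. -/
theorem raising_third_order {E₁ E₂ E₃ H₁ H₂ H₃ : V →ₗ[ℝ] V} {u₁ u₂ u₃ : V}
    (s12 : ∀ x, E₁ (E₁ (E₂ x)) - (2 : ℝ) • E₁ (E₂ (E₁ x)) + E₂ (E₁ (E₁ x)) = 0)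
    (s13 : ∀ x, E₁ (E₁ (E₃ x)) - (2 : ℝ) • E₁ (E₃ (E₁ x)) + E₃ (E₁ (E₁ x)) = 0)
    (s21 : ∀ x, E₂ (E₂ (E₁ x)) - (2 : ℝ) • E₂ (E₁ (E₂ x)) + E₁ (E₂ (E₂ x)) = 0)
    (s31 : ∀ x, E₃ (E₃ (E₁ x)) - (2 : ℝ) • E₃ (E₁ (E₃ x)) + E₁ (E₃ (E₃ x)) = 0)
    (h1 : ∀ x, E₁ (E₂ (E₃ x) - E₃ (E₂ x)) - (E₂ (E₃ (E₁ x)) - E₃ (E₂ (E₁ x))) = H₁ x)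
    (h2 : ∀ x, E₂ (E₃ (E₁ x) - E₁ (E₃ x)) - (E₃ (E₁ (E₂ x)) - E₁ (E₃ (E₂ x))) = H₂ x)
    (h3 : ∀ x, E₃ (E₁ (E₂ x) - E₂ (E₁ x)) - (E₁ (E₂ (E₃ x)) - E₂ (E₁ (E₃ x))) = H₃ x)
    (c11 : ∀ x, H₁ (E₁ x) = E₁ (H₁ x) - (2 : ℝ) • E₁ x)
    (c21 : ∀ x, H₂ (E₁ x) = E₁ (H₂ x) + E₁ x)
    (c31 : ∀ x, H₃ (E₁ x) = E₁ (H₃ x) + E₁ x)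
    (H11 : H₁ u₁ = -(2 : ℝ) • u₁) (H12 : H₁ u₂ = u₂) (H13 : H₁ u₃ = u₃)
    (H21 : H₂ u₁ = u₁) (H22 : H₂ u₂ = -(2 : ℝ) • u₂) (H33 : H₃ u₃ = -(2 : ℝ) • u₃)
    (k11 : E₁ u₁ = 0) (k22 : E₂ u₂ = 0) (k33 : E₃ u₃ = 0)
    (k12 : E₂ u₁ = -E₁ u₂) (k23 : E₃ u₂ = -E₂ u₃) (k31 : E₁ u₃ = -E₃ u₁) :
    E₁ (E₁ u₂) = 0 ∧ E₁ (E₃ u₁) = 0 ∧ E₁ (E₁ (E₂ u₃)) = (2 : ℝ) • u₁ ∧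
      E₁ (E₂ (E₃ u₁)) = -u₁ ∧ E₁ (E₃ (E₁ u₂)) = -u₁ := by
  have a1 := h1 u₁
  have a2 := h2 u₁
  have a3 := s12 u₃
  have a4 := s13 u₂
  have b1 := s12 u₁
  have b2 := s12 u₂
  have b3 := s21 u₁
  have b4 := s13 u₁
  have b5 := s13 u₃
  have b6 := s31 u₁
  simp only [k11, k22, k33, k12, k23, k31, H11, H21, map_neg, map_zero, map_sub, smul_neg,
    smul_zero] at a1 a2 a3 a4 b1 b2 b3 b4 b5 b6
  have e1 : E₁ (E₃ (E₁ u₂)) = -u₁ := by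
    linear_combination (norm := module) (1 / 3 : ℝ) • ((2 : ℝ) • a1 + a2 - a3 - a4)
  have e2 : E₁ (E₂ (E₃ u₁)) = -u₁ := by
    linear_combination (norm := module) a1 - e1
  -- Put `p = E₁ E₁ u₂` and `q = E₁ E₃ u₁`. Then `E₁` and `E₂` kill `p`, `E₁` and `E₃` kill `q`, and
  -- `t1` says `E₃ p = E₂ q`.
  have z1 : E₁ (E₁ (E₁ u₂)) = 0 := by
    linear_combination (norm := module) -b1
  have z2 : E₂ (E₁ (E₁ u₂)) = 0 := by
    linear_combination (norm := module) (1 / 3 : ℝ) • ((2 : ℝ) • b3 - b2)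
  have z3 : E₁ (E₁ (E₃ u₁)) = 0 := by
    linear_combination (norm := module) b4
  have z4 : E₃ (E₁ (E₃ u₁)) = 0 := by
    linear_combination (norm := module) (1 / 3 : ℝ) • (b5 - (2 : ℝ) • b6)
  have t1 : E₃ (E₁ (E₁ u₂)) = E₂ (E₁ (E₃ u₁)) := by
    linear_combination (norm := module) a3 + a4 - (2 : ℝ) • e2 + (2 : ℝ) • e1
  have t2 : E₃ (E₁ (E₁ u₂)) = E₁ (E₁ (E₂ u₃)) - (2 : ℝ) • u₁ := by
    linear_combination (norm := module) a4 + (2 : ℝ) • e1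
  -- By weights, `H₁ p = -3 p` and `H₂ p = 0`, which reduce to `E₁ E₂ E₃ p = -3 p` and `E₂ E₁ E₃ p =
  -- 0`. The Serre relation on `q`, with `E₂ q = E₃ p`, gives `E₁ E₂ E₃ p = 2 E₂ E₁ E₃ p`, so `p =
  -- 0`. The argument for `q` is symmetric.
  have d1 := h1 (E₁ (E₁ u₂))
  have d2 := h2 (E₁ (E₁ u₂))
  have d3 := h1 (E₁ (E₃ u₁))
  have d4 := h3 (E₁ (E₃ u₁))
  have d5 := s21 (E₁ (E₃ u₁))
  have d6 := s31 (E₁ (E₁ u₂))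
  have g3 : E₁ (E₃ u₁) = -E₁ (E₁ u₃) := by rw [k31, map_neg, neg_neg]
  have w1 : H₁ (E₁ (E₁ u₂)) = -(3 : ℝ) • E₁ (E₁ u₂) := by
    rw [c11, c11, H12]; simp only [map_sub, map_smul]; module
  have w2 : H₂ (E₁ (E₁ u₂)) = 0 := by
    rw [c21, c21, H22]; simp only [map_add, map_smul]; module
  have w3 : H₁ (E₁ (E₃ u₁)) = -(3 : ℝ) • E₁ (E₃ u₁) := by
    rw [g3, map_neg, c11, c11, H13]; simp only [map_sub, map_smul]; module
  have w4 : H₃ (E₁ (E₃ u₁)) = 0 := by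
    rw [g3, map_neg, c31, c31, H33]; simp only [map_add, map_smul]; module
  simp only [w1, w2, w3, w4, z1, z2, z3, z4, map_zero, map_sub, ← t1]
    at d1 d2 d3 d4 d5 d6
  have f1 : E₁ (E₁ u₂) = 0 := by
    linear_combination (norm := module) (1 / 3 : ℝ) • (d1 - d5 + (2 : ℝ) • d2)
  have f2 : E₁ (E₃ u₁) = 0 := by
    linear_combination (norm := module) (1 / 3 : ℝ) • (d3 + d6 + (2 : ℝ) • d4)
  refine ⟨f1, f2, ?_, e2, e1⟩
  rw [f1, map_zero] at t2
  linear_combination (norm := module) -t2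


/-- A cyclic triple `Eᵢ` of operators obeying the relations of the root vectors `e₂₁, e₃₂, e₁₃` of
`sl(3)`, with `Hᵢ = [Eᵢ, [Eᵢ₊₁, Eᵢ₊₂]]`, and vectors `uᵢ` such that `Eᵢ uⱼ + Eⱼ uᵢ = 0` and
`uᵢ` has the weight of `Eᵢ`. -/
structure IsKillingTriple (E H : Fin 3 → V →ₗ[ℝ] V) (u : Fin 3 → V) : Prop where
  serre : ∀ i j, i ≠ j → ∀ x,
    E i (E i (E j x)) - (2 : ℝ) • E i (E j (E i x)) + E j (E i (E i x)) = 0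
  triple : ∀ i x, E i (E (i + 1) (E (i + 2) x) - E (i + 2) (E (i + 1) x)) -
    (E (i + 1) (E (i + 2) (E i x)) - E (i + 2) (E (i + 1) (E i x))) = H i x
  comm_self : ∀ i x, H i (E i x) = E i (H i x) - (2 : ℝ) • E i x
  comm_ne : ∀ i j, i ≠ j → ∀ x, H i (E j x) = E j (H i x) + E j x
  weight_self : ∀ i, H i (u i) = -(2 : ℝ) • u i
  weight_ne : ∀ i j, i ≠ j → H i (u j) = u j
  kill : ∀ i j, E i (u j) = -E j (u i)

namespace IsKillingTriple

variable {E H : Fin 3 → V →ₗ[ℝ] V} {u : Fin 3 → V}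

theorem apply_self (h : IsKillingTriple E H u) (i : Fin 3) : E i (u i) = 0 := by
  have h2 := h.kill i i
  rw [eq_neg_iff_add_eq_zero, ← two_smul ℝ] at h2
  exact (smul_eq_zero.1 h2).resolve_left two_ne_zero

theorem third_order (h : IsKillingTriple E H u) (i : Fin 3) :
    E i (E i (u (i + 1))) = 0 ∧ E i (E (i + 2) (u i)) = 0 ∧
      E i (E i (E (i + 1) (u (i + 2)))) = (2 : ℝ) • u i ∧
      E i (E (i + 1) (E (i + 2) (u i))) = -u i ∧
      E i (E (i + 2) (E i (u (i + 1)))) = -u i := by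
  have n1 : i ≠ i + 1 := by fin_cases i <;> decide
  have n2 : i ≠ i + 2 := by fin_cases i <;> decide
  have i1 : i + 1 + 1 = i + 2 := by fin_cases i <;> rfl
  have i2 : i + 1 + 2 = i := by fin_cases i <;> rfl
  have i3 : i + 2 + 1 = i := by fin_cases i <;> rfl
  have i4 : i + 2 + 2 = i + 1 := by fin_cases i <;> rfl
  have t1 := h.triple (i + 1)
  have t2 := h.triple (i + 2)
  rw [i1, i2] at t1
  rw [i3, i4] at t2
  exact raising_third_order (h.serre i (i + 1) n1) (h.serre i (i + 2) n2)
    (h.serre (i + 1) i n1.symm) (h.serre (i + 2) i n2.symm) (h.triple i) t1 t2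
    (h.comm_self i) (h.comm_ne (i + 1) i n1.symm) (h.comm_ne (i + 2) i n2.symm)
    (h.weight_self i) (h.weight_ne i (i + 1) n1) (h.weight_ne i (i + 2) n2)
    (h.weight_ne (i + 1) i n1.symm) (h.weight_self (i + 1)) (h.weight_self (i + 2))
    (h.apply_self i) (h.apply_self (i + 1)) (h.apply_self (i + 2))
    (h.kill (i + 1) i) (h.kill (i + 2) (i + 1)) (h.kill i (i + 2))

/-- The vector `E₀ E₁ u₂` has `H₀`-weight zero, and each `Eᵢ` sends it to a known multiple of `uᵢ`.
Expanding `H₀` as a triple commutator on it therefore yields minus twice the sum. -/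
theorem sum_eq_zero (h : IsKillingTriple E H u) :
    E 0 (E 1 (u 2)) + E 1 (E 2 (u 0)) + E 2 (E 0 (u 1)) = 0 := by
  have a0 := (h.third_order 0).2.2.1
  have a1 := (h.third_order 1).2.2.2.2
  have a2 := (h.third_order 2).2.2.2.1
  have t := h.triple 0 (E 0 (E 1 (u 2)))
  simp only [Fin.isValue, Fin.reduceAdd, zero_add] at a0 a1 a2 t
  have w : H 0 (E 0 (E 1 (u 2))) = 0 := by
    rw [h.comm_self, h.comm_ne 0 1 (by decide), h.weight_ne 0 2 (by decide), map_add]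
    module
  rw [w, a0, a1, a2] at t
  simp only [map_neg, map_sub, map_smul, h.kill 2 1, h.kill 1 0] at t
  linear_combination (norm := module) -(1 / 2 : ℝ) • t

end IsKillingTriple

end RaisingOperators

/-! ### Homogeneity weights turn the fields `Zᵢ` into root vectors. -/

section Grading

variable {V : Type*} [AddCommGroup V] [Module ℝ V]

/-- The weight of the operator `Eᵢ`. -/
def rootWeight (i k : Fin 3) : ℝ := if k = i then -1 else if k = i + 1 then 1 else 0

/-- The operator `z i + l i` from weight `l` to weight `l + rootWeight i`. -/
noncomputable def gradedRaise (z : Fin 3 → V →ₗ[ℝ] V) (i : Fin 3) :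
    ((Fin 3 → ℝ) →₀ V) →ₗ[ℝ] ((Fin 3 → ℝ) →₀ V) :=
  Finsupp.lsum ℝ fun l => Finsupp.lsingle (l + rootWeight i) ∘ₗ (z i + l i • LinearMap.id)

/-- The operator `l i - l (i + 1)` on weight `l`. -/
noncomputable def gradedWeight (V : Type*) [AddCommGroup V] [Module ℝ V] (i : Fin 3) :
    ((Fin 3 → ℝ) →₀ V) →ₗ[ℝ] ((Fin 3 → ℝ) →₀ V) :=
  Finsupp.lsum ℝ fun l => Finsupp.lsingle l ∘ₗ ((l i - l (i + 1)) • LinearMap.id)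

theorem gradedRaise_single (z : Fin 3 → V →ₗ[ℝ] V) (i : Fin 3) (l : Fin 3 → ℝ) (x : V) :
    gradedRaise z i (Finsupp.single l x) =
      Finsupp.single (l + rootWeight i) (z i x + l i • x) := by
  simp [gradedRaise]

theorem gradedWeight_single (i : Fin 3) (l : Fin 3 → ℝ) (x : V) :
    gradedWeight V i (Finsupp.single l x) = Finsupp.single l ((l i - l (i + 1)) • x) := by
  simp [gradedWeight]

/-- The commutation relations of the vector fields `Zᵢ`, with `Wᵢ = [Zᵢ, Zᵢ₊₁]`. -/
structure ChaseRelations (z : Fin 3 → V →ₗ[ℝ] V) : Prop where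
  left : ∀ i x, z i (z i (z (i + 1) x)) - (2 : ℝ) • z i (z (i + 1) (z i x)) +
    z (i + 1) (z i (z i x)) = z i (z (i + 1) x) - z (i + 1) (z i x)
  right : ∀ i x, z (i + 1) (z (i + 1) (z i x)) - (2 : ℝ) • z (i + 1) (z i (z (i + 1) x)) +
    z i (z (i + 1) (z (i + 1) x)) = z i (z (i + 1) x) - z (i + 1) (z i x)
  triple : ∀ i x, z i (z (i + 1) (z (i + 2) x) - z (i + 2) (z (i + 1) x)) -
    (z (i + 1) (z (i + 2) (z i x)) - z (i + 2) (z (i + 1) (z i x))) =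
    z (i + 1) x - (z (i + 1) (z (i + 2) x) - z (i + 2) (z (i + 1) x)) - z i x +
      (z i (z (i + 1) x) - z (i + 1) (z i x))

variable {z : Fin 3 → V →ₗ[ℝ] V}

theorem rootWeight_cases (i : Fin 3) : rootWeight i i = -1 ∧ rootWeight i (i + 1) = 1 ∧
    rootWeight i (i + 2) = 0 ∧ rootWeight (i + 1) i = 0 ∧ rootWeight (i + 1) (i + 1) = -1 ∧
    rootWeight (i + 1) (i + 2) = 1 ∧ rootWeight (i + 2) i = 1 ∧
    rootWeight (i + 2) (i + 1) = 0 ∧ rootWeight (i + 2) (i + 2) = -1 := by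
  fin_cases i <;> simp [rootWeight]

theorem rootWeight_sum (i : Fin 3) :
    rootWeight i + rootWeight (i + 1) + rootWeight (i + 2) = 0 := by
  funext k
  fin_cases i <;> fin_cases k <;> simp [rootWeight]

/-- The `zᵢ` alone satisfy this relation only up to the lower-order term `[zᵢ, zᵢ₊₁]`. The shift by
`l i`, which changes as the operators move the weight, absorbs that term. All three words end in the
same weight, so the relation can be checked in one summand. -/
theorem gradedRaise_serre_left (hz : ChaseRelations z) (i : Fin 3) (x : (Fin 3 → ℝ) →₀ V) :
    gradedRaise z i (gradedRaise z i (gradedRaise z (i + 1) x)) -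
      (2 : ℝ) • gradedRaise z i (gradedRaise z (i + 1) (gradedRaise z i x)) +
      gradedRaise z (i + 1) (gradedRaise z i (gradedRaise z i x)) = 0 := by
  obtain ⟨r1, r2, -, r4, -, -⟩ := rootWeight_cases i
  induction x using Finsupp.induction_linear with
  | zero => simp
  | add f g hf hg =>
    simp only [map_add]
    linear_combination (norm := module) hf + hg
  | single l x =>
    simp only [gradedRaise_single]
    rw [add_right_comm l (rootWeight i) (rootWeight (i + 1)),
      add_right_comm (l + rootWeight i) (rootWeight i) (rootWeight (i + 1)),
      add_right_comm l (rootWeight i) (rootWeight (i + 1)), Finsupp.smul_single,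
      ← Finsupp.single_sub, ← Finsupp.single_add, Finsupp.single_eq_zero]
    simp only [Pi.add_apply, map_add, map_smul, r1, r2, r4]
    linear_combination (norm := module) hz.left i x

theorem gradedRaise_serre_right (hz : ChaseRelations z) (i : Fin 3) (x : (Fin 3 → ℝ) →₀ V) :
    gradedRaise z (i + 1) (gradedRaise z (i + 1) (gradedRaise z i x)) -
      (2 : ℝ) • gradedRaise z (i + 1) (gradedRaise z i (gradedRaise z (i + 1) x)) +
      gradedRaise z i (gradedRaise z (i + 1) (gradedRaise z (i + 1) x)) = 0 := by
  obtain ⟨-, r2, -, r4, r5, -⟩ := rootWeight_cases i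
  induction x using Finsupp.induction_linear with
  | zero => simp
  | add f g hf hg =>
    simp only [map_add]
    linear_combination (norm := module) hf + hg
  | single l x =>
    simp only [gradedRaise_single]
    rw [add_right_comm l (rootWeight i) (rootWeight (i + 1)),
      add_right_comm (l + rootWeight (i + 1)) (rootWeight i) (rootWeight (i + 1)),
      Finsupp.smul_single,
      ← Finsupp.single_sub, ← Finsupp.single_add, Finsupp.single_eq_zero]
    simp only [Pi.add_apply, map_add, map_smul, r2, r4, r5]
    linear_combination (norm := module) hz.right i x

/-- The three root weights sum to zero, so each word returns to weight `l`; the lower-order terms of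
the unshifted relation cancel and only the scalar `l i - l (i + 1)` survives. -/
theorem gradedRaise_triple (hz : ChaseRelations z) (i : Fin 3) (x : (Fin 3 → ℝ) →₀ V) :
    gradedRaise z i (gradedRaise z (i + 1) (gradedRaise z (i + 2) x) -
        gradedRaise z (i + 2) (gradedRaise z (i + 1) x)) -
      (gradedRaise z (i + 1) (gradedRaise z (i + 2) (gradedRaise z i x)) -
        gradedRaise z (i + 2) (gradedRaise z (i + 1) (gradedRaise z i x))) =
      gradedWeight V i x := by
  obtain ⟨-, r2, r3, r4, -, r6, r7, r8, -⟩ := rootWeight_cases i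
  induction x using Finsupp.induction_linear with
  | zero => simp
  | add f g hf hg =>
    simp only [map_add, map_sub] at *
    linear_combination (norm := module) hf + hg
  | single l x =>
    simp only [gradedRaise_single, gradedWeight_single, map_sub]
    have e1 : l + rootWeight (i + 2) + rootWeight (i + 1) + rootWeight i = l := by
      linear_combination rootWeight_sum i
    have e2 : l + rootWeight (i + 1) + rootWeight (i + 2) + rootWeight i = l := by
      linear_combination rootWeight_sum i
    have e3 : l + rootWeight i + rootWeight (i + 2) + rootWeight (i + 1) = l := by
      linear_combination rootWeight_sum i
    have e4 : l + rootWeight i + rootWeight (i + 1) + rootWeight (i + 2) = l := by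
      linear_combination rootWeight_sum i
    rw [e1, e2, e3, e4, ← Finsupp.single_sub, ← Finsupp.single_sub, ← Finsupp.single_sub]
    congr 1
    have t := hz.triple i x
    simp only [map_sub] at t
    simp only [Pi.add_apply, map_add, map_smul, r2, r3, r4, r6, r7, r8]
    linear_combination (norm := module) t

/-- The functions `φᵢ`, of weights `2, 1, 0` at `i, i + 1, i + 2`, satisfy the Killing type
equations `Eᵢ uⱼ + Eⱼ uᵢ = 0` for `uᵢ = φᵢ₊₁`. -/
structure ChaseKilling (z : Fin 3 → V →ₗ[ℝ] V) (φ : Fin 3 → V) : Prop where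
  self : ∀ i, z (i + 2) (φ i) = 0
  pair : ∀ i, z i (φ i) + (2 : ℝ) • φ i + (z (i + 2) (φ (i + 1)) + φ (i + 1)) = 0

/-- The weight of the vector `uᵢ`. -/
def killingWeight (i k : Fin 3) : ℝ := if k = i then 0 else if k = i + 1 then 2 else 1

/-- The vectors `uᵢ` of a Killing triple, with their weights. -/
noncomputable def killingVector (φ : Fin 3 → V) (i : Fin 3) : (Fin 3 → ℝ) →₀ V :=
  Finsupp.single (killingWeight i) (φ (i + 1))

theorem killingWeight_cases (i : Fin 3) : killingWeight i i = 0 ∧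
    killingWeight i (i + 1) = 2 ∧ killingWeight i (i + 2) = 1 := by
  fin_cases i <;> simp [killingWeight]

theorem gradedRaise_killingVector_self {φ : Fin 3 → V} (hφ : ChaseKilling z φ) (i : Fin 3) :
    gradedRaise z i (killingVector φ i) = 0 := by
  have h := hφ.self (i + 1)
  rw [show i + 1 + 2 = i by fin_cases i <;> rfl] at h
  rw [killingVector, gradedRaise_single, h, (killingWeight_cases i).1, zero_smul, add_zero,
    Finsupp.single_zero]

theorem gradedRaise_killingVector_succ {φ : Fin 3 → V} (hφ : ChaseKilling z φ) (i : Fin 3) :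
    gradedRaise z i (killingVector φ (i + 1)) =
      -gradedRaise z (i + 1) (killingVector φ i) := by
  have h := hφ.pair (i + 1)
  rw [show i + 1 + 2 = i by fin_cases i <;> rfl] at h
  have e1 : killingWeight (i + 1) i = 1 := by fin_cases i <;> simp [killingWeight]
  have e2 : killingWeight (i + 1) + rootWeight i = killingWeight i + rootWeight (i + 1) := by
    funext k
    fin_cases i <;> fin_cases k <;> simp [killingWeight, rootWeight] <;> norm_num
  rw [killingVector, killingVector, gradedRaise_single, gradedRaise_single, e1, e2,
    (killingWeight_cases i).2.1, ← Finsupp.single_neg]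
  congr 1
  linear_combination (norm := module) h

theorem isKillingTriple (hz : ChaseRelations z) {φ : Fin 3 → V} (hφ : ChaseKilling z φ) :
    IsKillingTriple (gradedRaise z) (gradedWeight V) (killingVector φ) where
  serre i j hij := by
    have : j = i + 1 ∨ i = j + 1 := by
      revert hij; fin_cases i <;> fin_cases j <;> decide
    rcases this with rfl | rfl
    · exact gradedRaise_serre_left hz i
    · exact gradedRaise_serre_right hz j
  triple := gradedRaise_triple hz
  comm_self i x := by
    obtain ⟨r1, r2, -⟩ := rootWeight_cases i
    induction x using Finsupp.induction_linear with
    | zero => simp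
    | add f g hf hg =>
      simp only [map_add]
      linear_combination (norm := module) hf + hg
    | single l x =>
      simp only [gradedRaise_single, gradedWeight_single]
      rw [Finsupp.smul_single, ← Finsupp.single_sub]
      congr 1
      simp only [Pi.add_apply, map_smul, r1, r2]
      module
  comm_ne i j hij x := by
    have hr : rootWeight j i - rootWeight j (i + 1) = 1 := by
      fin_cases i <;> fin_cases j <;> simp [rootWeight] at hij ⊢
    induction x using Finsupp.induction_linear with
    | zero => simp
    | add f g hf hg =>
      simp only [map_add]
      linear_combination (norm := module) hf + hg
    | single l x =>
      simp only [gradedRaise_single, gradedWeight_single]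
      rw [← Finsupp.single_add]
      congr 1
      simp only [Pi.add_apply, map_smul]
      linear_combination (norm := module) hr • (z j x + l j • x)
  weight_self i := by
    simp only [killingVector, gradedWeight_single]
    rw [Finsupp.smul_single]
    congr 1
    fin_cases i <;> simp [killingWeight]
  weight_ne i j hij := by
    simp only [killingVector, gradedWeight_single]
    congr 1
    have hk : killingWeight j i - killingWeight j (i + 1) = 1 := by
      fin_cases i <;> fin_cases j <;> simp [killingWeight] at hij ⊢ <;> norm_num
    rw [hk, one_smul]
  kill i j := by
    have : j = i ∨ j = i + 1 ∨ i = j + 1 := by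
      fin_cases i <;> fin_cases j <;> decide
    rcases this with rfl | rfl | rfl
    · rw [gradedRaise_killingVector_self hφ, neg_zero]
    · exact gradedRaise_killingVector_succ hφ i
    · rw [gradedRaise_killingVector_succ hφ j, neg_neg]

/-- The derivatives of `φᵢ`, of `ψᵢ = (zᵢ₊₁ + 1) φᵢ` and of `χᵢ = (zᵢ + 2) ψᵢ` are constant
combinations of these functions. -/
structure ChaseClosed (z : Fin 3 → V →ₗ[ℝ] V) (φ ψ χ : Fin 3 → V) : Prop where
  phi_self : ∀ i, z i (φ i) = -(2 : ℝ) • φ i - ψ (i + 1)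
  phi_succ : ∀ i, z (i + 1) (φ i) = ψ i - φ i
  phi_prev : ∀ i, z (i + 2) (φ i) = 0
  omega_self : ∀ i, z i (ψ i) = χ i - (2 : ℝ) • ψ i
  omega_succ : ∀ i, z (i + 1) (ψ i) = 0
  omega_prev : ∀ i, z (i + 2) (ψ i) = -ψ i
  pi_self : ∀ i, z i (χ i) = -χ i + (2 : ℝ) • φ (i + 1)
  pi_succ : ∀ i, z (i + 1) (χ i) = -χ i - φ (i + 2)
  pi_prev : ∀ i, z (i + 2) (χ i) = -χ i - φ i
  sum_pi : χ 0 + χ 1 + χ 2 = 0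

/-- `ψᵢ` and `χᵢ` are `Eᵢ₊₁ uᵢ₊₂` and `Eᵢ Eᵢ₊₁ uᵢ₊₂` with their weights forgotten. The algebraic
identities for Killing triples, read off in a single weight, are the remaining derivatives; the
shifts `lᵢ` produce the undifferentiated terms. -/
theorem ChaseKilling.closed (hz : ChaseRelations z) {φ ψ χ : Fin 3 → V}
    (hφ : ChaseKilling z φ) (hψ : ∀ i, ψ i = z (i + 1) (φ i) + φ i)
    (hχ : ∀ i, χ i = z i (ψ i) + (2 : ℝ) • ψ i) : ChaseClosed z φ ψ χ := by
  have K := isKillingTriple hz hφ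
  have hE : ∀ i, gradedRaise z (i + 1) (killingVector φ (i + 2)) =
      Finsupp.single (killingWeight (i + 2) + rootWeight (i + 1)) (ψ i) := by
    intro i
    have e : killingWeight (i + 2) (i + 1) = 1 := by fin_cases i <;> simp [killingWeight]
    rw [killingVector, gradedRaise_single, e, hψ, one_smul,
      show i + 2 + 1 = i by fin_cases i <;> rfl]
  have hw : ∀ i, (killingWeight (i + 2) + rootWeight (i + 1)) i = 2 ∧
      (killingWeight (i + 2) + rootWeight (i + 1)) (i + 1) = 0 ∧
      (killingWeight (i + 2) + rootWeight (i + 1)) (i + 2) = 1 := by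
    intro i
    fin_cases i <;> simp [killingWeight, rootWeight]
  have hEE : ∀ i, gradedRaise z i (gradedRaise z (i + 1) (killingVector φ (i + 2))) =
      Finsupp.single (fun _ => 1) (χ i) := by
    intro i
    rw [hE, gradedRaise_single, (hw i).1, ← hχ]
    congr 1
    funext k
    fin_cases i <;> fin_cases k <;> simp [killingWeight, rootWeight] <;> norm_num
  have j1 : ∀ i : Fin 3, i + 1 + 1 = i + 2 := by decide
  have j2 : ∀ i : Fin 3, i + 1 + 2 = i := by decide
  have j3 : ∀ i : Fin 3, i + 2 + 1 = i := by decide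
  have j4 : ∀ i : Fin 3, i + 2 + 2 = i + 1 := by decide
  -- All `χᵢ` have weight `(1, 1, 1)`, so `Eᵢ χⱼ` lies in the weight of `uᵢ` and the coefficients
  -- can be compared.
  have hkr : ∀ i, killingWeight i = (fun _ => (1 : ℝ)) + rootWeight i := by
    intro i
    funext k
    fin_cases i <;> fin_cases k <;> simp [killingWeight, rootWeight] <;> norm_num
  refine ⟨fun i => ?_, fun i => ?_, hφ.self, fun i => ?_, fun i => ?_, fun i => ?_,
    fun i => ?_, fun i => ?_, fun i => ?_, ?_⟩
  · have h := hφ.pair i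
    have h' := hψ (i + 1)
    rw [j1] at h'
    linear_combination (norm := module) h + h'
  · linear_combination (norm := module) -hψ i
  · linear_combination (norm := module) -hχ i
  · have h := (K.third_order (i + 1)).1
    rw [j1, hE, gradedRaise_single, (hw i).2.1, Finsupp.single_eq_zero] at h
    linear_combination (norm := module) h
  · have h := (K.third_order (i + 2)).2.1
    rw [j4, hE, gradedRaise_single, (hw i).2.2, Finsupp.single_eq_zero] at h
    linear_combination (norm := module) h
  · have h := (K.third_order i).2.2.1
    rw [hEE, gradedRaise_single, ← hkr, killingVector, Finsupp.smul_single] at h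
    linear_combination (norm := module) Finsupp.single_injective _ h
  · have h := (K.third_order (i + 1)).2.2.2.2
    rw [j1, j2, hEE, gradedRaise_single, ← hkr, killingVector, ← Finsupp.single_neg, j1] at h
    linear_combination (norm := module) Finsupp.single_injective _ h
  · have h := (K.third_order (i + 2)).2.2.2.1
    rw [j3, j4, hEE, gradedRaise_single, ← hkr, killingVector, ← Finsupp.single_neg, j3] at h
    linear_combination (norm := module) Finsupp.single_injective _ h
  · have h := K.sum_eq_zero
    have h0 := hEE 0
    have h1 := hEE 1
    have h2 := hEE 2
    simp only [Fin.isValue, Fin.reduceAdd, zero_add] at h0 h1 h2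
    rw [h0, h1, h2, ← Finsupp.single_add, ← Finsupp.single_add, Finsupp.single_eq_zero] at h
    exact h

end Grading

/-! ### The moving frame and its constant matrix. -/

section PointMatrix

variable {A : Type*} [CommRing A]

/-- The matrix whose columns are the points in homogeneous coordinates. -/
def pointMatrix (x y : Fin 3 → A) : Matrix (Fin 3) (Fin 3) A :=
  !![x 0, x 1, x 2; y 0, y 1, y 2; 1, 1, 1]

theorem det_pointMatrix (x y : Fin 3 → A) : (pointMatrix x y).det =
    (x 1 - x 0) * (y 2 - y 1) - (y 1 - y 0) * (x 2 - x 1) := by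
  rw [pointMatrix, Matrix.det_fin_three]
  simp
  ring

end PointMatrix

section DifferentialAlgebra

variable {A : Type*} [CommRing A] [Algebra ℝ A]

theorem map_derivation_mul (D : Derivation ℝ A A) (M N : Matrix (Fin 3) (Fin 3) A) :
    (M * N).map D = M.map D * N + M * N.map D := by
  ext k l
  simp only [Matrix.map_apply, Matrix.add_apply, Matrix.mul_apply, map_sum, Derivation.leibniz,
    smul_eq_mul, ← Finset.sum_add_distrib]
  exact Finset.sum_congr rfl fun j _ => by ring

/-- If `g' = g n` and `β' = β n - n β` then `g β g⁻¹` is constant. -/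
theorem map_derivation_conj_eq_zero (D : Derivation ℝ A A)
    {g G β n : Matrix (Fin 3) (Fin 3) A} (hG : g * G = 1) (hG' : G * g = 1)
    (hg : g.map D = g * n) (hβ : β.map D = β * n - n * β) : (g * β * G).map D = 0 := by
  have h1 : (1 : Matrix (Fin 3) (Fin 3) A).map D = 0 := by
    ext k l
    by_cases h : k = l <;> simp [h]
  have h2 : G.map D = -(n * G) := by
    have h := map_derivation_mul D g G
    rw [hG, h1, hg] at h
    have h' := congrArg (G * ·) h
    simp only [mul_zero, mul_add, ← mul_assoc, hG', one_mul] at h'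
    exact eq_neg_of_add_eq_zero_right h'.symm
  rw [map_derivation_mul, map_derivation_mul, hg, hβ, h2]
  noncomm_ring

/-- The differential algebra satisfied by the components of a symmetry: `D i` is the derivative
along `Zᵢ`, `(x i, y i)` are the coordinates, and `(a i, b i)` the components of the symmetry. -/
structure ChaseSymmetry (D : Fin 3 → Derivation ℝ A A) (x y a b : Fin 3 → A) : Prop where
  relations : ChaseRelations fun i => (D i : A →ₗ[ℝ] A)
  x_self : ∀ i, D i (x i) = x (i + 1) - x i
  y_self : ∀ i, D i (y i) = y (i + 1) - y i
  x_ne : ∀ i j, j ≠ i → D j (x i) = 0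
  y_ne : ∀ i j, j ≠ i → D j (y i) = 0
  off : ∀ i j, j ≠ i → D j (a i) * (y (i + 1) - y i) - D j (b i) * (x (i + 1) - x i) = 0
  diag : ∀ i, (a (i + 1) - a i - D i (a i)) * (y (i + 1) - y i) -
    (b (i + 1) - b i - D i (b i)) * (x (i + 1) - x i) = 0

namespace ChaseSymmetry

variable {D : Fin 3 → Derivation ℝ A A} {x y a b : Fin 3 → A}

/-- `φᵢ` and `ψᵢ` are the areas spanned by the component `(aᵢ, bᵢ)` with the vectors from point `i`
to points `i + 1` and `i + 2`. By `off`, a derivative `D j` with `j ≠ i` acts on `φᵢ` only through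
the motion of the points: `D (i + 2)` moves neither of them, and `D (i + 1)` moves point `i + 1`
towards point `i + 2`, turning `φᵢ` into `ψᵢ - φᵢ`. -/
theorem closed (h : ChaseSymmetry D x y a b) : ∃ χ : Fin 3 → A,
    ChaseClosed (fun i => (D i : A →ₗ[ℝ] A))
      (fun i => a i * (y (i + 1) - y i) - b i * (x (i + 1) - x i))
      (fun i => a i * (y (i + 2) - y i) - b i * (x (i + 2) - x i)) χ := by
  have n1 : ∀ i : Fin 3, i + 2 ≠ i := by decide
  have n2 : ∀ i : Fin 3, i + 2 ≠ i + 1 := by decide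
  have n3 : ∀ i : Fin 3, i + 1 ≠ i := by decide
  have j1 : ∀ i : Fin 3, i + 1 + 1 = i + 2 := by decide
  have j3 : ∀ i : Fin 3, i + 2 + 1 = i := by decide
  refine ⟨_, ChaseKilling.closed h.relations ⟨fun i => ?_, fun i => ?_⟩ (fun i => ?_)
    fun _ => rfl⟩
  · have := h.off i (i + 2) (n1 i)
    simp only [Derivation.coeFn_coe, map_sub, Derivation.leibniz, smul_eq_mul,
      h.x_ne _ _ (n1 i), h.x_ne _ _ (n2 i), h.y_ne _ _ (n1 i), h.y_ne _ _ (n2 i)]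
    linear_combination this
  · have e1 := h.diag i
    have e2 := h.off (i + 1) (i + 2) (n2 i)
    simp only [Derivation.coeFn_coe, map_sub, Derivation.leibniz, smul_eq_mul, j1,
      h.x_self, h.y_self, h.x_ne _ _ (n3 i).symm, h.y_ne _ _ (n3 i).symm,
      h.x_ne _ _ (n2 i), h.y_ne _ _ (n2 i), j3, two_smul] at e1 e2 ⊢
    linear_combination e2 - e1
  · have := h.off i (i + 1) (n3 i)
    simp only [Derivation.coeFn_coe, map_sub, Derivation.leibniz, smul_eq_mul, j1,
      h.x_self, h.y_self, h.x_ne _ _ (n3 i), h.y_ne _ _ (n3 i)]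
    linear_combination -this

/-- The matrix of `D i` acting on `pointMatrix` from the right. -/
def stepMatrix (A : Type*) [CommRing A] (i : Fin 3) : Matrix (Fin 3) (Fin 3) A :=
  Matrix.single (i + 1) i 1 - Matrix.single i i 1

theorem map_pointMatrix (h : ChaseSymmetry D x y a b) (i : Fin 3) :
    (pointMatrix x y).map (D i) = pointMatrix x y * stepMatrix A i := by
  ext k l
  fin_cases i <;> fin_cases k <;> fin_cases l <;>
    simp [pointMatrix, stepMatrix, Matrix.mul_apply, Fin.sum_univ_three, h.x_self, h.y_self,
      h.x_ne, h.y_ne, Matrix.single_apply] <;> ring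

/-- The matrix of the symmetry in the frame of the three points, times the area. -/
noncomputable def frameMatrix (φ ψ χ : Fin 3 → A) : Matrix (Fin 3) (Fin 3) A :=
  !![(1 / 3 : ℝ) • (χ 2 - χ 0), -φ 1, ψ 2; ψ 0, (1 / 3 : ℝ) • (χ 0 - χ 1), -φ 2;
    -φ 0, ψ 1, (1 / 3 : ℝ) • (χ 1 - χ 2)]

/-- The commutator is the change of frame. The extra `-frameMatrix` comes from the factor area,
whose derivative along each `Zᵢ` is its own negative; it disappears after division by the area. -/
theorem map_frameMatrix {φ ψ χ : Fin 3 → A}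
    (h : ChaseClosed (fun i => (D i : A →ₗ[ℝ] A)) φ ψ χ) (i : Fin 3) :
    (frameMatrix φ ψ χ).map (D i) = frameMatrix φ ψ χ * stepMatrix A i -
      stepMatrix A i * frameMatrix φ ψ χ - frameMatrix φ ψ χ := by
  obtain ⟨f1, f2, f3, w1, w2, w3, p1, p2, p3, hs⟩ := h
  simp only [Derivation.coeFn_coe] at f1 f2 f3 w1 w2 w3 p1 p2 p3
  have hs' : χ 2 = -χ 0 - χ 1 := by linear_combination hs
  have f10 := f1 0
  have f11 := f1 1
  have f12 := f1 2
  have f20 := f2 0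
  have f21 := f2 1
  have f22 := f2 2
  have f30 := f3 0
  have f31 := f3 1
  have f32 := f3 2
  have w10 := w1 0
  have w11 := w1 1
  have w12 := w1 2
  have w20 := w2 0
  have w21 := w2 1
  have w22 := w2 2
  have w30 := w3 0
  have w31 := w3 1
  have w32 := w3 2
  have p10 := p1 0
  have p11 := p1 1
  have p20 := p2 0
  have p21 := p2 1
  have p30 := p3 0
  have p31 := p3 1
  simp only [Fin.isValue, Fin.reduceAdd, zero_add] at f10 f11 f12 f20 f21 f22 f30 f31 f32
  simp only [Fin.isValue, Fin.reduceAdd, zero_add] at w10 w11 w12 w20 w21 w22 w30 w31 w32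
  simp only [Fin.isValue, Fin.reduceAdd, zero_add] at p10 p11 p20 p21 p30 p31
  ext k l
  rw [Matrix.map_apply, Matrix.sub_apply, Matrix.sub_apply, Matrix.mul_apply, Matrix.mul_apply,
    Fin.sum_univ_three, Fin.sum_univ_three, frameMatrix, hs']
  fin_cases i <;> fin_cases k <;> fin_cases l <;>
    simp [stepMatrix, f10, f11, f12, f20, f21, f22, f30, f31, f32, w10, w11, w12, w20, w21, w22,
      w30, w31, w32, p10, p11, p20, p21, p30, p31, hs'] <;> module

/-- By Cramer's rule `(aᵢ, bᵢ)` is `(ψᵢ (rᵢ₊₁ - rᵢ) - φᵢ (rᵢ₊₂ - rᵢ)) / area`, so the off-diagonal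
entries of the frame matrix reproduce the symmetry. The traceless diagonal built from `χ` is what
makes the conjugated matrix constant. -/
theorem exists_constant_matrix (h : ChaseSymmetry D x y a b) {d : A}
    (hd : d * (pointMatrix x y).det = 1) : ∃ B : Matrix (Fin 3) (Fin 3) A,
      (∀ i k l, D i (B k l) = 0) ∧
      (∀ i, a i = B 0 0 * x i + B 0 1 * y i + B 0 2 -
        x i * (B 2 0 * x i + B 2 1 * y i + B 2 2)) ∧
      ∀ i, b i = B 1 0 * x i + B 1 1 * y i + B 1 2 -
        y i * (B 2 0 * x i + B 2 1 * y i + B 2 2) := by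
  obtain ⟨χ, hc⟩ := h.closed
  set φ : Fin 3 → A := fun i => a i * (y (i + 1) - y i) - b i * (x (i + 1) - x i) with hφ
  set ψ : Fin 3 → A := fun i => a i * (y (i + 2) - y i) - b i * (x (i + 2) - x i) with hψ
  have hdet : ∀ i, D i (pointMatrix x y).det = -(pointMatrix x y).det := by
    intro i
    rw [det_pointMatrix]
    fin_cases i <;> simp [h.x_self, h.y_self, h.x_ne, h.y_ne] <;> ring
  have hDd : ∀ i, D i d = d := by
    intro i
    have e := congrArg (D i) hd
    rw [Derivation.leibniz, hdet, Derivation.map_one_eq_zero, smul_eq_mul, smul_eq_mul] at e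
    linear_combination d * e + (d - D i d) * hd
  have hu : IsUnit (pointMatrix x y).det := IsUnit.of_mul_eq_one_right _ hd
  set g := pointMatrix x y with hg
  set β := d • frameMatrix φ ψ χ with hβ
  have hG := Matrix.mul_nonsing_inv g hu
  have hG' := Matrix.nonsing_inv_mul g hu
  have hDβ : ∀ i, β.map (D i) = β * stepMatrix A i - stepMatrix A i * β := by
    intro i
    have e : β.map (D i) = d • (frameMatrix φ ψ χ).map (D i) + d • frameMatrix φ ψ χ := by
      ext k l
      simp [hβ, hDd, mul_comm]
    rw [e, map_frameMatrix hc, hβ, Matrix.smul_mul, Matrix.mul_smul, smul_sub, smul_sub]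
    abel
  have hB : g * β * g⁻¹ * g = g * β := by rw [mul_assoc, hG', mul_one]
  have hkey : ∀ k i, (g * β * g⁻¹) k 0 * x i + (g * β * g⁻¹) k 1 * y i + (g * β * g⁻¹) k 2 =
      (g * β) k i := by
    intro k i
    have e : ∀ M : Matrix (Fin 3) (Fin 3) A,
        (M * g) k i = M k 0 * x i + M k 1 * y i + M k 2 := by
      intro M
      rw [Matrix.mul_apply, Fin.sum_univ_three]
      fin_cases i <;> simp [hg, pointMatrix]
    rw [← e, hB]
  rw [det_pointMatrix] at hd
  refine ⟨g * β * g⁻¹, fun i k l => ?_, fun i => ?_, fun i => ?_⟩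
  · exact congrFun (congrFun (map_derivation_conj_eq_zero (D i) hG hG' (h.map_pointMatrix i)
      (hDβ i)) k) l
  · rw [hkey, hkey, Matrix.mul_apply, Matrix.mul_apply, Fin.sum_univ_three, Fin.sum_univ_three]
    rw [hβ, frameMatrix]
    -- The diagonal entries only rescale the homogeneous vectors of the points, so they drop out of
    -- the affine components.
    generalize (1 / 3 : ℝ) • (χ 2 - χ 0) = m₀
    generalize (1 / 3 : ℝ) • (χ 0 - χ 1) = m₁
    generalize (1 / 3 : ℝ) • (χ 1 - χ 2) = m₂
    fin_cases i <;> simp [hg, pointMatrix, hφ, hψ]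
    · linear_combination -a 0 * hd
    · linear_combination -a 1 * hd
    · linear_combination -a 2 * hd
  · rw [hkey, hkey, Matrix.mul_apply, Matrix.mul_apply, Fin.sum_univ_three, Fin.sum_univ_three]
    rw [hβ, frameMatrix]
    generalize (1 / 3 : ℝ) • (χ 2 - χ 0) = m₀
    generalize (1 / 3 : ℝ) • (χ 0 - χ 1) = m₁
    generalize (1 / 3 : ℝ) • (χ 1 - χ 2) = m₂
    fin_cases i <;> simp [hg, pointMatrix, hφ, hψ]
    · linear_combination -b 0 * hd
    · linear_combination -b 1 * hd
    · linear_combination -b 2 * hd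

end ChaseSymmetry

end DifferentialAlgebra

/-! ### Smooth functions on an open set and their derivations. -/

section SmoothRing

variable {E : Type*} [NormedAddCommGroup E] [NormedSpace ℝ E]

/-- The ring of smooth real functions on the open set `W`. -/
def smoothRing (W : TopologicalSpace.Opens E) : Subalgebra ℝ (W → ℝ) where
  carrier := {f | ∃ F : E → ℝ, ContDiffOn ℝ ∞ F W ∧ ∀ q : W, f q = F q}
  mul_mem' := by
    rintro f g ⟨F, hF, hf⟩ ⟨G, hG, hg⟩
    exact ⟨fun q => F q * G q, hF.mul hG, fun q => by rw [Pi.mul_apply, hf, hg]⟩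
  add_mem' := by
    rintro f g ⟨F, hF, hf⟩ ⟨G, hG, hg⟩
    exact ⟨fun q => F q + G q, hF.add hG, fun q => by rw [Pi.add_apply, hf, hg]⟩
  algebraMap_mem' c := ⟨fun _ => c, contDiffOn_const, fun _ => rfl⟩

variable {W : TopologicalSpace.Opens E}

/-- The element of `smoothRing W` given by a function smooth on `W`. -/
def smoothRingOf (F : E → ℝ) (hF : ContDiffOn ℝ ∞ F W) : smoothRing W :=
  ⟨fun q => F q, F, hF, fun _ => rfl⟩

/-- The extension by zero of a smooth function on `W`. -/
noncomputable def extendZero (f : smoothRing W) : E → ℝ :=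
  Function.extend Subtype.val f.1 0

theorem extendZero_apply (f : smoothRing W) (q : W) : extendZero f q = f.1 q :=
  Subtype.val_injective.extend_apply _ _ _

theorem extendZero_eventuallyEq (f : smoothRing W) {F : E → ℝ}
    (hf : ∀ q : W, f.1 q = F q) (q : W) : extendZero f =ᶠ[nhds (q : E)] F := by
  filter_upwards [W.isOpen.mem_nhds q.2] with p hp
  exact (extendZero_apply f ⟨p, hp⟩).trans (hf ⟨p, hp⟩)

theorem contDiffOn_extendZero (f : smoothRing W) : ContDiffOn ℝ ∞ (extendZero f) W := by
  obtain ⟨F, hF, hf⟩ := f.2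
  exact hF.congr fun q hq => (extendZero_apply f ⟨q, hq⟩).trans (hf ⟨q, hq⟩)

theorem contDiffOn_fderiv_top {F : Type*} [NormedAddCommGroup F] [NormedSpace ℝ F] {f : E → F}
    (hf : ContDiffOn ℝ ∞ f W) : ContDiffOn ℝ ∞ (fderiv ℝ f) W :=
  hf.fderiv_of_isOpen W.isOpen (by simp)

theorem differentiableAt_extendZero (f : smoothRing W) (q : W) :
    DifferentiableAt ℝ (extendZero f) q :=
  ((contDiffOn_extendZero f).contDiffAt (W.isOpen.mem_nhds q.2)).differentiableAt (by simp)

/-- The derivation of `smoothRing W` along a linear vector field. -/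
noncomputable def dirDeriv (L : E →L[ℝ] E) : Derivation ℝ (smoothRing W) (smoothRing W) :=
  Derivation.mk'
    { toFun := fun f => ⟨fun q => fderiv ℝ (extendZero f) q (L q),
        fun q => fderiv ℝ (extendZero f) q (L q),
        (contDiffOn_fderiv_top (contDiffOn_extendZero f)).clm_apply L.contDiff.contDiffOn,
        fun _ => rfl⟩
      map_add' := fun f g => by
        ext q
        have h : extendZero (f + g) =ᶠ[nhds (q : E)] extendZero f + extendZero g :=
          extendZero_eventuallyEq (f + g) (fun p => by
            rw [Pi.add_apply, extendZero_apply f, extendZero_apply g]; rfl) q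
        change fderiv ℝ (extendZero (f + g)) q (L q) = _
        rw [h.fderiv_eq, fderiv_add (differentiableAt_extendZero f q)
          (differentiableAt_extendZero g q)]
        rfl
      map_smul' := fun c f => by
        ext q
        have h : extendZero (c • f) =ᶠ[nhds (q : E)] c • extendZero f :=
          extendZero_eventuallyEq (c • f) (fun p => by
            rw [Pi.smul_apply, extendZero_apply f]; rfl) q
        change fderiv ℝ (extendZero (c • f)) q (L q) = _
        rw [h.fderiv_eq, fderiv_const_smul (differentiableAt_extendZero f q)]
        rfl }
    fun f g => by
      ext q
      have h : extendZero (f * g) =ᶠ[nhds (q : E)] extendZero f * extendZero g :=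
        extendZero_eventuallyEq (f * g) (fun p => by
          rw [Pi.mul_apply, extendZero_apply f, extendZero_apply g]; rfl) q
      change fderiv ℝ (extendZero (f * g)) q (L q) = _
      rw [h.fderiv_eq, fderiv_mul (differentiableAt_extendZero f q)
        (differentiableAt_extendZero g q)]
      simp [extendZero_apply f, extendZero_apply g]

theorem dirDeriv_apply (L : E →L[ℝ] E) {f : smoothRing W} {F : E → ℝ}
    (hf : ∀ q : W, f.1 q = F q) (q : W) : (dirDeriv L f).1 q = fderiv ℝ F q (L q) := by
  rw [← (extendZero_eventuallyEq f hf q).fderiv_eq]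
  rfl

/-- The second-order terms cancel by symmetry of the second derivative, leaving the commutator of
the linear maps in reverse order. -/
theorem dirDeriv_commutator {L M N : E →L[ℝ] E} (h : ∀ q, M (L q) - L (M q) = N q)
    (f : smoothRing W) :
    dirDeriv L (dirDeriv M f) - dirDeriv M (dirDeriv L f) = dirDeriv N f := by
  ext q
  have hf := (contDiffOn_extendZero f).contDiffAt (W.isOpen.mem_nhds q.2)
  have hdf : DifferentiableAt ℝ (fderiv ℝ (extendZero f)) q :=
    ((contDiffOn_fderiv_top (contDiffOn_extendZero f)).contDiffAt
      (W.isOpen.mem_nhds q.2)).differentiableAt (by simp)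
  have key : ∀ K : E →L[ℝ] E, ∀ v, fderiv ℝ (fun p => fderiv ℝ (extendZero f) p (K p)) q v =
      fderiv ℝ (fderiv ℝ (extendZero f)) q v (K q) + fderiv ℝ (extendZero f) q (K v) := by
    intro K v
    rw [(hdf.hasFDerivAt.clm_apply K.hasFDerivAt).fderiv]
    simp [add_comm]
  have hs := hf.isSymmSndFDerivAt minSmoothness_le
  change (dirDeriv L (dirDeriv M f)).1 q - (dirDeriv M (dirDeriv L f)).1 q = (dirDeriv N f).1 q
  have k1 := key M (L q)
  have k2 := key L (M q)
  rw [hs (M q) (L q)] at k2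
  calc _ = fderiv ℝ (fun p => fderiv ℝ (extendZero f) p (M p)) q (L q) -
        fderiv ℝ (fun p => fderiv ℝ (extendZero f) p (L p)) q (M q) := by
        rw [dirDeriv_apply L (F := fun p => fderiv ℝ (extendZero f) p (M p)) fun _ => rfl,
          dirDeriv_apply M (F := fun p => fderiv ℝ (extendZero f) p (L p)) fun _ => rfl]
    _ = fderiv ℝ (extendZero f) q (N q) := by
        rw [k1, k2, ← h, map_sub]
        ring

end SmoothRing

/-! ### The symmetry equations as identities between derivations. -/

section ChaseDerivations

variable {U W : TopologicalSpace.Opens Config}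

/-- The linear map `q ↦ Wᵢ(q)`. -/
noncomputable def crossMap (i : Fin 3) : Config →L[ℝ] Config :=
  (ContinuousLinearMap.single ℝ (fun _ : Fin 3 => ℝ × ℝ) i).comp
    (ContinuousLinearMap.proj (R := ℝ) (φ := fun _ : Fin 3 => ℝ × ℝ) (i + 1) -
      ContinuousLinearMap.proj (R := ℝ) (φ := fun _ : Fin 3 => ℝ × ℝ) (i + 1 + 1))

theorem crossMap_apply (i : Fin 3) (q : Config) : crossMap i q = crossField i q := by
  change (Pi.single i (q (i + 1) - q (i + 1 + 1)) : Config) =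
    (Pi.single i (-(q (i + 1 + 1) - q (i + 1))) : Config)
  rw [neg_sub]

theorem crossField_apply (i k : Fin 3) (q : Config) :
    crossField i q k = if k = i then q (i + 1) - q (i + 2) else 0 := by
  by_cases h : k = i
  · subst h
    fin_cases k <;> simp [crossField, edge]
  · simp [crossField, h]

theorem chaseField_apply (i k : Fin 3) (q : Config) :
    chaseField i q k = if k = i then q (i + 1) - q i else 0 := by
  by_cases h : k = i
  · subst h
    simp [chaseField_eq, edge]
  · simp [chaseField_eq, h]

theorem dirDeriv_chaseMap_commutator (i : Fin 3) (f : smoothRing W) :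
    dirDeriv (chaseMap i) (dirDeriv (chaseMap (i + 1)) f) -
      dirDeriv (chaseMap (i + 1)) (dirDeriv (chaseMap i) f) = dirDeriv (crossMap i) f :=
  dirDeriv_commutator (fun q => by
    rw [crossMap_apply, ← chaseField_commutator]; rfl) f

theorem dirDeriv_cross_left (i : Fin 3) (f : smoothRing W) :
    dirDeriv (chaseMap i) (dirDeriv (crossMap i) f) -
      dirDeriv (crossMap i) (dirDeriv (chaseMap i) f) = dirDeriv (crossMap i) f :=
  dirDeriv_commutator (fun q => by
    simp only [crossMap_apply, chaseMap_apply]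
    funext k
    simp only [Pi.sub_apply, crossField_apply, chaseField_apply]
    fin_cases i <;> fin_cases k <;> simp) f

theorem dirDeriv_cross_right (i : Fin 3) (f : smoothRing W) :
    dirDeriv (crossMap i) (dirDeriv (chaseMap (i + 1)) f) -
      dirDeriv (chaseMap (i + 1)) (dirDeriv (crossMap i) f) = dirDeriv (crossMap i) f :=
  dirDeriv_commutator (fun q => by
    simp only [crossMap_apply, chaseMap_apply]
    funext k
    simp only [Pi.sub_apply, crossField_apply, chaseField_apply]
    fin_cases i <;> fin_cases k <;> simp) f

theorem dirDeriv_cross_prev (i : Fin 3) (f : smoothRing W) :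
    dirDeriv (chaseMap i) (dirDeriv (crossMap (i + 1)) f) -
      dirDeriv (crossMap (i + 1)) (dirDeriv (chaseMap i) f) =
      dirDeriv (chaseMap (i + 1)) f - dirDeriv (crossMap (i + 1)) f -
        dirDeriv (chaseMap i) f + dirDeriv (crossMap i) f := by
  rw [dirDeriv_commutator (N := chaseMap (i + 1) - crossMap (i + 1) - chaseMap i + crossMap i)
    (fun q => by
      simp only [add_apply, sub_apply, crossMap_apply,
        chaseMap_apply]
      funext k
      simp only [Pi.sub_apply, Pi.add_apply, crossField_apply, chaseField_apply]
      fin_cases i <;> fin_cases k <;> simp) f]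
  ext q
  change fderiv ℝ (extendZero f) q (chaseMap (i + 1) q - crossMap (i + 1) q - chaseMap i q +
    crossMap i q) = fderiv ℝ (extendZero f) q (chaseMap (i + 1) q) -
      fderiv ℝ (extendZero f) q (crossMap (i + 1) q) -
      fderiv ℝ (extendZero f) q (chaseMap i q) + fderiv ℝ (extendZero f) q (crossMap i q)
  simp only [map_add, map_sub]

theorem chaseRelations : ChaseRelations fun i =>
    (dirDeriv (chaseMap i) : Derivation ℝ (smoothRing W) (smoothRing W)).toLinearMap where
  left i f := by
    have h := dirDeriv_cross_left i f
    rw [← dirDeriv_chaseMap_commutator, ← dirDeriv_chaseMap_commutator, map_sub] at h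
    simp only [Derivation.coeFn_coe]
    linear_combination (norm := module) h
  right i f := by
    have h := dirDeriv_cross_right i f
    rw [← dirDeriv_chaseMap_commutator, ← dirDeriv_chaseMap_commutator, map_sub] at h
    simp only [Derivation.coeFn_coe]
    linear_combination (norm := module) h
  triple i f := by
    have h := dirDeriv_cross_prev i f
    have i1 : i + 1 + 1 = i + 2 := by fin_cases i <;> rfl
    rw [← dirDeriv_chaseMap_commutator, ← dirDeriv_chaseMap_commutator,
      ← dirDeriv_chaseMap_commutator, i1] at h
    simp only [Derivation.coeFn_coe]
    linear_combination (norm := module) h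

/-- Testing the symmetry condition on the three generators `Zⱼ` already yields all the equations
used to determine `X`. -/
theorem cross_edge_symmetry {X : smoothFields U}
    (hX : X ∈ symmetryAlgebra velocityDistribution U) {q : Config} (hq : q ∈ U) (i j : Fin 3) :
    cross (chaseField j (X.1 q) i - fderiv ℝ X.1 q (chaseField j q) i) (edge i q) = 0 := by
  have h := cross_eq_zero_of_mem ((hX _ (chaseField_isSectionOn j U)).2 q hq) i
  rwa [VectorField.lieBracket, ← coe_chaseMap, ContinuousLinearMap.fderiv] at h

theorem contDiffOn_coord {X : Config → Config} (hX : ContDiffOn ℝ ∞ X W) (i : Fin 3) :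
    ContDiffOn ℝ ∞ (fun q => (X q i).1) W ∧ ContDiffOn ℝ ∞ (fun q => (X q i).2) W :=
  ⟨(contDiffOn_pi.1 hX i).fst, (contDiffOn_pi.1 hX i).snd⟩

theorem fderiv_coord {X : Config → Config} {q : Config} (hX : DifferentiableAt ℝ X q)
    (i : Fin 3) (v : Config) : fderiv ℝ (fun p => (X p i).1) q v = (fderiv ℝ X q v i).1 ∧
      fderiv ℝ (fun p => (X p i).2) q v = (fderiv ℝ X q v i).2 := by
  have h : HasFDerivAt (fun p => X p i)
      ((ContinuousLinearMap.proj (R := ℝ) (φ := fun _ : Fin 3 => ℝ × ℝ) i).comp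
        (fderiv ℝ X q)) q := (hasFDerivAt_pi'.1 hX.hasFDerivAt) i
  rw [h.fst.fderiv, h.snd.fderiv]
  exact ⟨rfl, rfl⟩

/-- The `∂ₓ` components of a vector field smooth on `W`. -/
noncomputable def coordFst (X : Config → Config) (hX : ContDiffOn ℝ ∞ X W)
    (i : Fin 3) : smoothRing W :=
  smoothRingOf (fun q => (X q i).1) (contDiffOn_coord hX i).1

/-- The `∂_y` components of a vector field smooth on `W`. -/
noncomputable def coordSnd (X : Config → Config) (hX : ContDiffOn ℝ ∞ X W)
    (i : Fin 3) : smoothRing W :=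
  smoothRingOf (fun q => (X q i).2) (contDiffOn_coord hX i).2

theorem dirDeriv_coord {X : Config → Config} (hX : ContDiffOn ℝ ∞ X W)
    (L : Config →L[ℝ] Config) (i : Fin 3) (q : W) :
    (dirDeriv L (coordFst X hX i)).1 q = (fderiv ℝ X q (L q) i).1 ∧
      (dirDeriv L (coordSnd X hX i)).1 q = (fderiv ℝ X q (L q) i).2 := by
  rw [dirDeriv_apply L (F := fun q => (X q i).1) fun _ => rfl,
    dirDeriv_apply L (F := fun q => (X q i).2) fun _ => rfl]
  exact fderiv_coord (smoothFields_differentiableAt hX q.2) i (L q)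

theorem chaseSymmetry_of_mem {X : smoothFields U}
    (hX : X ∈ symmetryAlgebra velocityDistribution U) (hWU : (W : Set Config) ⊆ U) :
    ChaseSymmetry (fun i => (dirDeriv (chaseMap i) : Derivation ℝ (smoothRing W) (smoothRing W)))
      (coordFst id contDiffOn_id) (coordSnd id contDiffOn_id)
      (coordFst X.1 (X.2.1.mono hWU)) (coordSnd X.1 (X.2.1.mono hWU)) where
  relations := chaseRelations
  x_self i := by
    ext q
    rw [(dirDeriv_coord _ _ _ _).1, fderiv_id]
    change (chaseField i q i).1 = _
    rw [chaseField_apply, if_pos rfl]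
    rfl
  y_self i := by
    ext q
    rw [(dirDeriv_coord _ _ _ _).2, fderiv_id]
    change (chaseField i q i).2 = _
    rw [chaseField_apply, if_pos rfl]
    rfl
  x_ne i j hij := by
    ext q
    rw [(dirDeriv_coord _ _ _ _).1, fderiv_id]
    change (chaseField j q i).1 = _
    rw [chaseField_apply, if_neg hij.symm]
    rfl
  y_ne i j hij := by
    ext q
    rw [(dirDeriv_coord _ _ _ _).2, fderiv_id]
    change (chaseField j q i).2 = _
    rw [chaseField_apply, if_neg hij.symm]
    rfl
  off i j hij := by
    ext q
    have h := cross_edge_symmetry hX (hWU q.2) i j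
    rw [chaseField_apply, if_neg hij.symm, zero_sub] at h
    have d1 := (dirDeriv_coord (X.2.1.mono hWU) (chaseMap j) i q).1
    have d2 := (dirDeriv_coord (X.2.1.mono hWU) (chaseMap j) i q).2
    change (dirDeriv (chaseMap j) (coordFst X.1 (X.2.1.mono hWU) i)).1 q *
      ((q.1 (i + 1)).2 - (q.1 i).2) -
      (dirDeriv (chaseMap j) (coordSnd X.1 (X.2.1.mono hWU) i)).1 q *
      ((q.1 (i + 1)).1 - (q.1 i).1) = 0
    rw [d1, d2]
    simp only [cross, edge, Prod.fst_neg, Prod.snd_neg, Prod.fst_sub, Prod.snd_sub] at h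
    rw [chaseMap_apply]
    linarith
  diag i := by
    ext q
    have h := cross_edge_symmetry hX (hWU q.2) i i
    rw [chaseField_apply, if_pos rfl] at h
    have d1 := (dirDeriv_coord (X.2.1.mono hWU) (chaseMap i) i q).1
    have d2 := (dirDeriv_coord (X.2.1.mono hWU) (chaseMap i) i q).2
    change ((X.1 q (i + 1)).1 - (X.1 q i).1 -
        (dirDeriv (chaseMap i) (coordFst X.1 (X.2.1.mono hWU) i)).1 q) *
      ((q.1 (i + 1)).2 - (q.1 i).2) - ((X.1 q (i + 1)).2 - (X.1 q i).2 -
        (dirDeriv (chaseMap i) (coordSnd X.1 (X.2.1.mono hWU) i)).1 q) *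
      ((q.1 (i + 1)).1 - (q.1 i).1) = 0
    rw [d1, d2]
    simp only [cross, edge, Prod.fst_sub, Prod.snd_sub] at h
    rw [chaseMap_apply]
    linarith

end ChaseDerivations

/-! ### Projective vector fields are symmetries. -/

section ProjectiveFields

/-- The infinitesimal projective transformation of the plane given by a `3 × 3` matrix. -/
def projVec (B : Matrix (Fin 3) (Fin 3) ℝ) (r : ℝ × ℝ) : ℝ × ℝ :=
  (B 0 0 * r.1 + B 0 1 * r.2 + B 0 2 - r.1 * (B 2 0 * r.1 + B 2 1 * r.2 + B 2 2),
    B 1 0 * r.1 + B 1 1 * r.2 + B 1 2 - r.2 * (B 2 0 * r.1 + B 2 1 * r.2 + B 2 2))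

/-- The derivative of `projVec B` at `r` in the direction `w`. -/
def projVecDeriv (B : Matrix (Fin 3) (Fin 3) ℝ) (r w : ℝ × ℝ) : ℝ × ℝ :=
  (B 0 0 * w.1 + B 0 1 * w.2 - w.1 * (B 2 0 * r.1 + B 2 1 * r.2 + B 2 2) -
      r.1 * (B 2 0 * w.1 + B 2 1 * w.2),
    B 1 0 * w.1 + B 1 1 * w.2 - w.2 * (B 2 0 * r.1 + B 2 1 * r.2 + B 2 2) -
      r.2 * (B 2 0 * w.1 + B 2 1 * w.2))

/-- The diagonal action of `projVec B` on the three points. -/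
def homField (B : Matrix (Fin 3) (Fin 3) ℝ) (q : Config) : Config := fun i => projVec B (q i)

theorem contDiff_projVec (B : Matrix (Fin 3) (Fin 3) ℝ) : ContDiff ℝ ∞ (projVec B) := by
  unfold projVec
  fun_prop

theorem contDiff_homField (B : Matrix (Fin 3) (Fin 3) ℝ) : ContDiff ℝ ∞ (homField B) :=
  contDiff_pi.2 fun i => (contDiff_projVec B).comp (contDiff_apply ℝ (ℝ × ℝ) i)

theorem fderiv_projVec (B : Matrix (Fin 3) (Fin 3) ℝ) (r w : ℝ × ℝ) :
    fderiv ℝ (projVec B) r w = projVecDeriv B r w := by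
  have h1 : HasFDerivAt (fun r : ℝ × ℝ => r.1) (ContinuousLinearMap.fst ℝ ℝ ℝ) r :=
    hasFDerivAt_fst
  have h2 : HasFDerivAt (fun r : ℝ × ℝ => r.2) (ContinuousLinearMap.snd ℝ ℝ ℝ) r :=
    hasFDerivAt_snd
  have hl : ∀ a b c : ℝ, HasFDerivAt (fun r : ℝ × ℝ => a * r.1 + b * r.2 + c)
      (a • ContinuousLinearMap.fst ℝ ℝ ℝ + b • ContinuousLinearMap.snd ℝ ℝ ℝ) r :=
    fun a b c => ((h1.const_mul a).add (h2.const_mul b)).add_const c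
  have h : HasFDerivAt (projVec B) _ r :=
    ((hl (B 0 0) (B 0 1) (B 0 2)).sub
      (h1.mul (hl (B 2 0) (B 2 1) (B 2 2)))).prodMk
    ((hl (B 1 0) (B 1 1) (B 1 2)).sub (h2.mul (hl (B 2 0) (B 2 1) (B 2 2))))
  rw [h.fderiv]
  ext <;> simp [projVecDeriv] <;> ring

theorem fderiv_homField (B : Matrix (Fin 3) (Fin 3) ℝ) (q w : Config) (i : Fin 3) :
    fderiv ℝ (homField B) q w i = projVecDeriv B (q i) (w i) := by
  have hd : DifferentiableAt ℝ (projVec B) (q i) :=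
    (contDiff_projVec B).differentiable (by simp) _
  have h := hd.hasFDerivAt.comp q (hasFDerivAt_apply (𝕜 := ℝ) (F' := fun _ : Fin 3 => ℝ × ℝ) i q)
  have h' : DifferentiableAt ℝ (homField B) q :=
    (contDiff_homField B).differentiable (by simp) _
  have e := ((hasFDerivAt_pi'.1 h'.hasFDerivAt) i).unique h
  rw [← fderiv_projVec]
  exact congrArg (fun L => L w) e

theorem lieBracket_homField (B C : Matrix (Fin 3) (Fin 3) ℝ) (q : Config) :
    VectorField.lieBracket ℝ (homField B) (homField C) q = homField (C * B - B * C) q := by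
  funext i
  rw [VectorField.lieBracket, Pi.sub_apply, fderiv_homField, fderiv_homField]
  ext <;> simp [homField, projVecDeriv, projVec, Matrix.mul_apply, Fin.sum_univ_three] <;> ring

theorem homField_add (B C : Matrix (Fin 3) (Fin 3) ℝ) (q : Config) :
    homField (B + C) q = homField B q + homField C q := by
  funext i
  ext <;> simp [homField, projVec] <;> ring

theorem homField_smul (c : ℝ) (B : Matrix (Fin 3) (Fin 3) ℝ) (q : Config) :
    homField (c • B) q = c • homField B q := by
  funext i
  ext <;> simp [homField, projVec] <;> ring

theorem homField_add_smul_one (c : ℝ) (B : Matrix (Fin 3) (Fin 3) ℝ) (q : Config) :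
    homField (B + c • 1) q = homField B q := by
  funext i
  ext <;> simp [homField, projVec] <;> ring

/-- Infinitesimally, a projective map sends the line through two points to the line through their
images. A section need not have smooth coefficients in the `Zᵢ` where points coincide, so the
argument differentiates the relation `cross (Y i) (edge i) = 0` instead of expanding `Y`. -/
theorem lieBracket_homField_mem {U : TopologicalSpace.Opens Config} {Y : Config → Config}
    (hY : IsSectionOn velocityDistribution U Y) (B : Matrix (Fin 3) (Fin 3) ℝ) {q : Config}
    (hq : q ∈ U) : VectorField.lieBracket ℝ (homField B) Y q ∈ velocityDistribution q := by
  rw [mem_velocityDistribution_iff]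
  intro i
  obtain ⟨c, hc⟩ := mem_velocityDistribution_iff.1 (hY.2 q hq) i
  have hb : VectorField.lieBracket ℝ (homField B) Y q i =
      fderiv ℝ Y q (homField B q) i - projVecDeriv B (q i) (Y q i) := by
    rw [VectorField.lieBracket, Pi.sub_apply, fderiv_homField]
  -- At coincident points the cross product gives no information. But both points then have the same
  -- velocity under the projective field, so `edge i` stays zero along the straight line in
  -- direction `homField B q`; hence `Y i` vanishes along it and so does its derivative.
  by_cases h0 : edge i q = 0
  · have hw : edge i (homField B q) = 0 := by
      have : q (i + 1) = q i := sub_eq_zero.1 h0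
      simp [edge, homField, this]
    have hd := (smoothFields_differentiableAt hY.1 hq).hasFDerivAt.hasLineDerivAt (homField B q)
    have hdi := (hasDerivAt_pi.1 hd) i
    have hzero : (fun t : ℝ => Y (q + t • homField B q) i) =ᶠ[nhds 0] fun _ => 0 := by
      have hcont : Continuous fun t : ℝ => q + t • homField B q := by fun_prop
      have : ∀ᶠ t in nhds (0 : ℝ), q + t • homField B q ∈ U :=
        hcont.continuousAt.eventually_mem (U.isOpen.mem_nhds (by simpa using hq))
      filter_upwards [this] with t ht
      obtain ⟨d, hd⟩ := mem_velocityDistribution_iff.1 (hY.2 _ ht) i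
      have he : edge i (q + t • homField B q) = edge i q + t • edge i (homField B q) := by
        simp only [edge, Pi.add_apply, Pi.smul_apply, smul_sub]
        abel
      rw [hd, he, h0, hw]
      simp
    have e := hdi.unique ((hasDerivAt_const (0 : ℝ) (0 : ℝ × ℝ)).congr_of_eventuallyEq hzero)
    refine ⟨0, ?_⟩
    rw [hb, e, hc, h0]
    ext <;> simp [projVecDeriv]
  · apply exists_smul_of_cross_eq_zero h0
    have h := cross_fderiv_section hY hq (homField B q) i
    rw [hb, hc]
    have hr : q (i + 1) = q i + edge i q := by simp [edge]
    rw [hc, show edge i (homField B q) = projVec B (q i + edge i q) - projVec B (q i) by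
      rw [← hr]; rfl] at h
    generalize edge i q = v at *
    simp only [cross, projVec, projVecDeriv, Prod.fst_sub, Prod.snd_sub, Prod.fst_add,
      Prod.snd_add, Prod.smul_fst, Prod.smul_snd, smul_eq_mul] at h ⊢
    linear_combination h

/-- The symmetry of the velocity distribution given by a matrix. -/
noncomputable def homSymmetry (U : TopologicalSpace.Opens Config)
    (B : Matrix (Fin 3) (Fin 3) ℝ) : symmetryAlgebra velocityDistribution U :=
  ⟨restrictField U (homField B) (contDiff_homField B), fun Y hY =>
    ⟨contDiffOn_lieBracket (restrictField U _ (contDiff_homField B)).2.1 hY.1, fun q hq => by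
      have h : (restrictField U _ (contDiff_homField B)).1 =ᶠ[nhds q] homField B := by
        filter_upwards [U.isOpen.mem_nhds hq] with p hp using Set.indicator_of_mem hp _
      rw [h.lieBracket_vectorField_eq (Filter.EventuallyEq.refl _ Y)]
      exact lieBracket_homField_mem hY B hq⟩⟩

theorem homSymmetry_apply (U : TopologicalSpace.Opens Config) (B : Matrix (Fin 3) (Fin 3) ℝ)
    {q : Config} (hq : q ∈ U) : (homSymmetry U B).1.1 q = homField B q :=
  Set.indicator_of_mem (s := (U : Set Config)) hq _

/-- The matrix of the linear combination of the fields `projectiveField k` with coefficients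
`c k`. -/
def coeffMatrix (c : Fin 8 → ℝ) : Matrix (Fin 3) (Fin 3) ℝ :=
  !![c 4, c 2, c 0; c 3, c 5, c 1; -c 7, -c 6, 0]

theorem homField_coeffMatrix (c : Fin 8 → ℝ) (q : Config) :
    homField (coeffMatrix c) q = ∑ k, c k • projectiveField k q := by
  funext i
  rw [Finset.sum_apply]
  ext <;> simp [homField, projVec, coeffMatrix, projectiveField, Fin.sum_univ_eight] <;> ring

theorem homField_eq_coeffMatrix (B : Matrix (Fin 3) (Fin 3) ℝ) (q : Config) :
    homField B q = homField (coeffMatrix ![B 0 2, B 1 2, B 0 1, B 1 0, B 0 0 - B 2 2,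
      B 1 1 - B 2 2, -B 2 1, -B 2 0]) q := by
  funext i
  ext <;> simp [homField, projVec, coeffMatrix] <;> ring

/-- Moving only one point inside `U` makes the quadratic field `projVec B` vanish on an open square
of the plane, so all its coefficients vanish; these determine `B` up to a scalar matrix. -/
theorem eq_smul_one_of_homField_eq_zero {U : TopologicalSpace.Opens Config}
    (hU : (U : Set Config).Nonempty) {B : Matrix (Fin 3) (Fin 3) ℝ}
    (hB : ∀ q ∈ U, homField B q = 0) : B = B 2 2 • 1 := by
  obtain ⟨q, hq⟩ := hU
  have hc : Continuous fun p : ℝ × ℝ => Function.update q 0 (q 0 + p) :=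
    continuous_const.update 0 (continuous_const.add continuous_id)
  have hn : ∀ᶠ p in nhds (0 : ℝ × ℝ), Function.update q 0 (q 0 + p) ∈ U :=
    hc.continuousAt.eventually_mem (U.isOpen.mem_nhds (by simpa using hq))
  obtain ⟨ε, hε, hball⟩ := Metric.eventually_nhds_iff.1 hn
  have hP : ∀ s t : ℝ, |s| < ε → |t| < ε → projVec B (q 0 + (s, t)) = 0 := by
    intro s t hs ht
    have h := congrFun (hB _ (hball (y := (s, t)) (by
      rw [dist_zero_right, Prod.norm_def]; exact max_lt hs ht))) 0
    simpa [homField] using h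
  generalize q 0 = r at hP
  set h := ε / 2 with hh
  have h0 : h ≠ 0 := by positivity
  have l0 : |(0 : ℝ)| < ε := by simpa
  have l1 : |h| < ε := by rw [abs_of_pos (by positivity)]; linarith
  have l2 : |-h| < ε := by rwa [abs_neg]
  -- Five sample points suffice: second differences isolate the quadratic coefficients `B 2 0` and
  -- `B 2 1`, after which first differences give the linear ones.
  have e1 := hP 0 0 l0 l0
  have e2 := hP h 0 l1 l0
  have e3 := hP (-h) 0 l2 l0
  have e4 := hP 0 h l0 l1
  have e5 := hP h h l1 l1
  simp only [projVec, Prod.mk_eq_zero, Prod.fst_add, Prod.snd_add] at e1 e2 e3 e4 e5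
  have b20 : B 2 0 = 0 := by
    have : B 2 0 * h ^ 2 = 0 := by linear_combination e1.1 - (1 / 2) * e2.1 - (1 / 2) * e3.1
    simpa [h0] using this
  have b21 : B 2 1 = 0 := by
    have : B 2 1 * h ^ 2 = 0 := by linear_combination e2.1 + e4.1 - e5.1 - e1.1
    simpa [h0] using this
  rw [b20, b21] at e1 e2 e4
  have b01 : B 0 1 = 0 := by
    have : B 0 1 * h = 0 := by linear_combination e4.1 - e1.1
    simpa [h0] using this
  have b10 : B 1 0 = 0 := by
    have : B 1 0 * h = 0 := by linear_combination e2.2 - e1.2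
    simpa [h0] using this
  have b00 : B 0 0 = B 2 2 := by
    have : (B 0 0 - B 2 2) * h = 0 := by linear_combination e2.1 - e1.1
    simpa [h0, sub_eq_zero] using this
  have b11 : B 1 1 = B 2 2 := by
    have : (B 1 1 - B 2 2) * h = 0 := by linear_combination e4.2 - e1.2
    simpa [h0, sub_eq_zero] using this
  have b02 : B 0 2 = 0 := by
    have := e1.1
    rw [b01, b00] at this
    linear_combination this
  have b12 : B 1 2 = 0 := by
    have := e1.2
    rw [b10, b11] at this
    linear_combination this
  ext i j
  fin_cases i <;> fin_cases j <;> simp [b20, b21, b01, b10, b00, b11, b02, b12]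

end ProjectiveFields

/-! ### Unique continuation through third derivatives. -/

section UniqueContinuation

variable {E F : Type*} [NormedAddCommGroup E] [NormedSpace ℝ E] [NormedAddCommGroup F]
  [NormedSpace ℝ F] {U : TopologicalSpace.Opens E}

theorem eq_zero_of_fderiv_eq_zero (hU : IsPreconnected (U : Set E)) {f : E → F}
    (hf : ContDiffOn ℝ ∞ f U) (hf' : ∀ q ∈ U, fderiv ℝ f q = 0) {q₀ : E} (hq₀ : q₀ ∈ U)
    (h₀ : f q₀ = 0) : ∀ q ∈ U, f q = 0 := fun q hq => by
  rw [← h₀]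
  exact U.isOpen.is_const_of_fderiv_eq_zero (𝕜 := ℝ) hU (hf.differentiableOn (by simp))
    hf' hq hq₀

/-- A smooth function on a connected open set which vanishes near a point, and whose third
derivative vanishes on a dense subset, is zero. -/
theorem eq_zero_of_third_fderiv_eq_zero (hU : IsPreconnected (U : Set E)) {f : E → F}
    (hf : ContDiffOn ℝ ∞ f U) {W : Set E} (hW : ∀ q ∈ U, q ∈ closure W)
    (hf' : ∀ q ∈ W, fderiv ℝ (fderiv ℝ (fderiv ℝ f)) q = 0) {q₀ : E} (hq₀ : q₀ ∈ U)
    (h₀ : f =ᶠ[nhds q₀] 0) : ∀ q ∈ U, f q = 0 := by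
  have s1 := contDiffOn_fderiv_top hf
  have s2 := contDiffOn_fderiv_top s1
  have s3 := contDiffOn_fderiv_top s2
  have z1 : fderiv ℝ f =ᶠ[nhds q₀] 0 := by
    filter_upwards [h₀.fderiv (𝕜 := ℝ)] with q hq
    simp [hq]
  have z2 : fderiv ℝ (fderiv ℝ f) =ᶠ[nhds q₀] 0 := by
    filter_upwards [z1.fderiv (𝕜 := ℝ)] with q hq
    simp [hq]
  have h3 : ∀ q ∈ U, fderiv ℝ (fderiv ℝ (fderiv ℝ f)) q = 0 := by
    intro q hq
    have hc : Filter.Tendsto (fderiv ℝ (fderiv ℝ (fderiv ℝ f))) (nhdsWithin q W)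
        (nhds (fderiv ℝ (fderiv ℝ (fderiv ℝ f)) q)) :=
      ((s3.continuousOn.continuousAt (U.isOpen.mem_nhds hq)).tendsto).mono_left
        nhdsWithin_le_nhds
    have : (nhdsWithin q W).NeBot := mem_closure_iff_nhdsWithin_neBot.1 (hW q hq)
    refine tendsto_nhds_unique hc (tendsto_const_nhds.congr' ?_)
    filter_upwards [self_mem_nhdsWithin] with p hp using (hf' p hp).symm
  exact eq_zero_of_fderiv_eq_zero hU hf (eq_zero_of_fderiv_eq_zero hU s1
    (eq_zero_of_fderiv_eq_zero hU s2 h3 hq₀ z2.self_of_nhds) hq₀ z1.self_of_nhds) hq₀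
    h₀.self_of_nhds

theorem third_fderiv_quadratic (c : ℝ) (l₁ l₂ l₃ : E →L[ℝ] ℝ) (q : E) :
    fderiv ℝ (fderiv ℝ (fderiv ℝ fun q => c + l₁ q + l₂ q * l₃ q)) q = 0 := by
  have h1 : fderiv ℝ (fun q => c + l₁ q + l₂ q * l₃ q) =
      fun q => l₁ + (l₂.smulRight l₃ + l₃.smulRight l₂) q := by
    funext q
    have h := (l₁.hasFDerivAt (x := q).const_add c).add
      (l₂.hasFDerivAt (x := q).mul (l₃.hasFDerivAt (x := q)))
    refine HasFDerivAt.fderiv (h.congr_fderiv ?_)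
    simp
  have h2 : fderiv ℝ (fun q => l₁ + (l₂.smulRight l₃ + l₃.smulRight l₂) q) =
      fun _ => l₂.smulRight l₃ + l₃.smulRight l₂ := by
    funext q
    exact ((l₂.smulRight l₃ + l₃.smulRight l₂).hasFDerivAt.const_add l₁).fderiv
  rw [h1, h2]
  simp

end UniqueContinuation

/-! ### From local to global, and the isomorphism with `sl(3)`. -/

section Symmetries

variable {U : TopologicalSpace.Opens Config}

theorem third_fderiv_homField_fst (B : Matrix (Fin 3) (Fin 3) ℝ) (i : Fin 3) (q : Config) :
    fderiv ℝ (fderiv ℝ (fderiv ℝ fun q => (homField B q i).1)) q = 0 := by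
  let X := (ContinuousLinearMap.fst ℝ ℝ ℝ).comp
    (ContinuousLinearMap.proj (R := ℝ) (φ := fun _ : Fin 3 => ℝ × ℝ) i)
  let Y := (ContinuousLinearMap.snd ℝ ℝ ℝ).comp
    (ContinuousLinearMap.proj (R := ℝ) (φ := fun _ : Fin 3 => ℝ × ℝ) i)
  rw [← third_fderiv_quadratic (B 0 2) ((B 0 0 - B 2 2) • X + B 0 1 • Y) X
    (-(B 2 0 • X + B 2 1 • Y)) q]
  congr 3
  funext q
  change (projVec B (q i)).1 = B 0 2 + ((B 0 0 - B 2 2) * (q i).1 + B 0 1 * (q i).2) +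
    (q i).1 * -(B 2 0 * (q i).1 + B 2 1 * (q i).2)
  simp only [projVec]
  ring

theorem third_fderiv_homField_snd (B : Matrix (Fin 3) (Fin 3) ℝ) (i : Fin 3) (q : Config) :
    fderiv ℝ (fderiv ℝ (fderiv ℝ fun q => (homField B q i).2)) q = 0 := by
  let X := (ContinuousLinearMap.fst ℝ ℝ ℝ).comp
    (ContinuousLinearMap.proj (R := ℝ) (φ := fun _ : Fin 3 => ℝ × ℝ) i)
  let Y := (ContinuousLinearMap.snd ℝ ℝ ℝ).comp
    (ContinuousLinearMap.proj (R := ℝ) (φ := fun _ : Fin 3 => ℝ × ℝ) i)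
  rw [← third_fderiv_quadratic (B 1 2) (B 1 0 • X + (B 1 1 - B 2 2) • Y) Y
    (-(B 2 0 • X + B 2 1 • Y)) q]
  congr 3
  funext q
  change (projVec B (q i)).2 = B 1 2 + (B 1 0 * (q i).1 + (B 1 1 - B 2 2) * (q i).2) +
    (q i).2 * -(B 2 0 * (q i).1 + B 2 1 * (q i).2)
  simp only [projVec]
  ring

theorem contDiff_area : ContDiff ℝ ∞ area := by
  unfold area cross edge
  fun_prop

/-- The noncollinear configurations in `U`. -/
def noncollinear (U : TopologicalSpace.Opens Config) : TopologicalSpace.Opens Config :=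
  ⟨U ∩ {q | area q ≠ 0}, U.isOpen.inter (isOpen_ne_fun contDiff_area.continuous continuous_const)⟩

/-- Along the direction `e`, a triangle with `area e = 1`, the area of `q + t • e` is a quadratic
polynomial in `t` with leading coefficient 1, so it cannot vanish at the three values `0`, `ε / 2`,
`-ε / 2`. -/
theorem mem_closure_noncollinear {q : Config} (hq : q ∈ U) :
    q ∈ closure (noncollinear U : Set Config) := by
  rw [mem_closure_iff_nhds]
  intro N hN
  by_contra hne
  rw [Set.not_nonempty_iff_eq_empty] at hne
  have hz : ∀ p ∈ N, p ∈ U → area p = 0 := by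
    intro p hp hpU
    by_contra h
    have : p ∈ N ∩ (noncollinear U : Set Config) := ⟨hp, hpU, h⟩
    rw [hne] at this
    exact this
  let e : Config := ![(0, 0), (1, 0), (0, 1)]
  have hc : Continuous fun t : ℝ => q + t • e := by fun_prop
  have hev : ∀ᶠ t in nhds (0 : ℝ), q + t • e ∈ N ∩ U :=
    hc.continuousAt.eventually_mem (by
      simpa using Filter.inter_mem hN (U.isOpen.mem_nhds hq))
  obtain ⟨ε, hε, hball⟩ := Metric.eventually_nhds_iff.1 hev
  have ha : ∀ t : ℝ, |t| < ε → area (q + t • e) = 0 := fun t ht =>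
    have := hball (y := t) (by simpa using ht)
    hz _ this.1 this.2
  have h0 := ha 0 (by simpa)
  have h1 := ha (ε / 2) (by rw [abs_of_pos (by positivity)]; linarith)
  have h2 := ha (-(ε / 2)) (by rw [abs_neg, abs_of_pos (by positivity)]; linarith)
  simp [area, cross, edge, e] at h0 h1 h2
  nlinarith

/-- A function annihilated by the `Zᵢ` is annihilated by their brackets, and at nonzero area these
span the tangent space. -/
theorem fderiv_extendZero_eq_zero {W : TopologicalSpace.Opens Config} (f : smoothRing W)
    (hf : ∀ i, dirDeriv (chaseMap i) f = 0) (q : W) (hq : area q ≠ 0) :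
    fderiv ℝ (extendZero f) q = 0 := by
  have hf' : ∀ i, dirDeriv (crossMap i) f = 0 := by
    intro i
    rw [← dirDeriv_chaseMap_commutator, hf, hf, map_zero, map_zero, sub_zero]
  have h := span_chaseField_crossField hq
    (S := LinearMap.ker (fderiv ℝ (extendZero f) q).toLinearMap)
    (fun i => congrArg (fun g : smoothRing W => g.1 q) (hf i))
    (fun i => by
      rw [← crossMap_apply]
      exact congrArg (fun g : smoothRing W => g.1 q) (hf' i))
  ext1 v
  exact (h ▸ Submodule.mem_top : v ∈ LinearMap.ker (fderiv ℝ (extendZero f) q).toLinearMap)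

/-- Near a noncollinear configuration every symmetry is projective. -/
theorem eventually_eq_homField {X : smoothFields U}
    (hX : X ∈ symmetryAlgebra velocityDistribution U) {q₀ : Config}
    (hq₀ : q₀ ∈ noncollinear U) :
    ∃ B : Matrix (Fin 3) (Fin 3) ℝ, X.1 =ᶠ[nhds q₀] homField B := by
  have hWU : (noncollinear U : Set Config) ⊆ U := fun q hq => hq.1
  have hinv : ContDiffOn ℝ ∞ (fun q => (area q)⁻¹) (noncollinear U) :=
    contDiff_area.contDiffOn.inv fun q hq => hq.2
  obtain ⟨B, hB, h1, h2⟩ := (chaseSymmetry_of_mem hX hWU).exists_constant_matrix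
    (d := smoothRingOf _ hinv) (by
      rw [det_pointMatrix]
      ext q
      exact inv_mul_cancel₀ q.2.2)
  refine ⟨fun k l => (B k l).1 ⟨q₀, hq₀⟩, ?_⟩
  obtain ⟨ε, hε, hball⟩ := Metric.isOpen_iff.1 (noncollinear U).isOpen q₀ hq₀
  have hconst : ∀ k l, ∀ q (hq : q ∈ Metric.ball q₀ ε),
      (B k l).1 ⟨q, hball hq⟩ = (B k l).1 ⟨q₀, hq₀⟩ := by
    intro k l q hq
    rw [← extendZero_apply, ← extendZero_apply]
    exact Metric.isOpen_ball.is_const_of_fderiv_eq_zero (𝕜 := ℝ)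
      (convex_ball q₀ ε).isPreconnected
      (((contDiffOn_extendZero (B k l)).mono hball).differentiableOn (by simp))
      (fun p hp => fderiv_extendZero_eq_zero (B k l) (fun i => hB i k l) ⟨p, hball hp⟩
        (hball hp).2) hq (Metric.mem_ball_self hε)
  filter_upwards [Metric.ball_mem_nhds q₀ hε] with q hq
  funext i
  have e1 := congrArg (fun g : smoothRing (noncollinear U) => g.1 ⟨q, hball hq⟩) (h1 i)
  have e2 := congrArg (fun g : smoothRing (noncollinear U) => g.1 ⟨q, hball hq⟩) (h2 i)
  simp only [homField, projVec]
  simp only [← hconst _ _ q hq]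
  exact Prod.ext e1 e2

/-- The matrix found near a noncollinear configuration could a priori depend on the component of the
noncollinear set. Fixing one such `B`, the difference from `homField B` is locally quadratic
whatever the other matrices are, so its third derivative vanishes on a dense set; as it also
vanishes near `q₀`, it is zero on the connected `U`. -/
theorem exists_eq_homField (hU : IsConnected (U : Set Config)) {X : smoothFields U}
    (hX : X ∈ symmetryAlgebra velocityDistribution U) :
    ∃ B : Matrix (Fin 3) (Fin 3) ℝ, ∀ q ∈ U, X.1 q = homField B q := by
  obtain ⟨p, hp⟩ := hU.nonempty
  obtain ⟨q₀, hq₀⟩ : (noncollinear U : Set Config).Nonempty :=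
    closure_nonempty_iff.1 ⟨p, mem_closure_noncollinear hp⟩
  obtain ⟨B, hB⟩ := eventually_eq_homField hX hq₀
  refine ⟨B, fun q hq => ?_⟩
  have hdiff : ∀ p C, X.1 =ᶠ[nhds p] homField C →
      X.1 - homField B =ᶠ[nhds p] homField (C - B) := by
    intro p C h
    filter_upwards [h] with r hr
    rw [Pi.sub_apply, hr, sub_eq_add_neg C, ← neg_one_smul ℝ B, homField_add, homField_smul,
      neg_one_smul, sub_eq_add_neg]
  have hs : ContDiffOn ℝ ∞ (X.1 - homField B) U := X.2.1.sub (contDiff_homField B).contDiffOn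
  have hz : ∀ r, homField (B - B) r = 0 := by
    intro r
    rw [sub_self, ← zero_smul ℝ (0 : Matrix (Fin 3) (Fin 3) ℝ), homField_smul, zero_smul]
  have key : (X.1 - homField B) q = 0 := by
    funext i
    refine Prod.ext ?_ ?_
    · refine eq_zero_of_third_fderiv_eq_zero hU.isPreconnected (contDiffOn_coord hs i).1
        (fun _ => mem_closure_noncollinear) (fun r hr => ?_) hq₀.1 ?_ q hq
      · obtain ⟨C, hC⟩ := eventually_eq_homField hX hr
        rw [← third_fderiv_homField_fst (C - B) i r]
        have h := (hdiff r C hC).fun_comp fun v => (v i).1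
        exact h.fderiv.fderiv.fderiv_eq
      · filter_upwards [hdiff q₀ B hB] with r hr
        rw [hr, hz]
        rfl
    · refine eq_zero_of_third_fderiv_eq_zero hU.isPreconnected (contDiffOn_coord hs i).2
        (fun _ => mem_closure_noncollinear) (fun r hr => ?_) hq₀.1 ?_ q hq
      · obtain ⟨C, hC⟩ := eventually_eq_homField hX hr
        rw [← third_fderiv_homField_snd (C - B) i r]
        have h := (hdiff r C hC).fun_comp fun v => (v i).2
        exact h.fderiv.fderiv.fderiv_eq
      · filter_upwards [hdiff q₀ B hB] with r hr
        rw [hr, hz]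
        rfl
  exact sub_eq_zero.1 key

/-- The action of `sl(3)` by symmetries of the velocity distribution. -/
noncomputable def slHom (U : TopologicalSpace.Opens Config) :
    LieAlgebra.SpecialLinear.sl (Fin 3) ℝ →ₗ⁅ℝ⁆ symmetryAlgebra velocityDistribution U where
  -- The bracket of the fields of `B` and `C` is the field of `C * B - B * C`; the minus sign turns
  -- this anti-homomorphism into a homomorphism.
  toFun B := homSymmetry U (-B.1)
  map_add' B C := Subtype.ext <| smoothFields_ext fun q hq => by
    change (homSymmetry U _).1.1 q = (homSymmetry U _).1.1 q + (homSymmetry U _).1.1 q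
    rw [homSymmetry_apply U _ hq, homSymmetry_apply U _ hq, homSymmetry_apply U _ hq,
      ← homField_add, ← neg_add]
    rfl
  map_smul' c B := Subtype.ext <| smoothFields_ext fun q hq => by
    change (homSymmetry U _).1.1 q = c • (homSymmetry U _).1.1 q
    rw [homSymmetry_apply U _ hq, homSymmetry_apply U _ hq, ← homField_smul, smul_neg]
    rfl
  map_lie' {B C} := Subtype.ext <| smoothFields_ext fun q hq => by
    have h : ∀ D : Matrix (Fin 3) (Fin 3) ℝ,
        (homSymmetry U D).1.1 =ᶠ[nhds q] homField D := fun D => by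
      filter_upwards [U.isOpen.mem_nhds hq] with p hp using homSymmetry_apply U D hp
    change (homSymmetry U _).1.1 q =
      (⁅(homSymmetry U (-B.1)).1, (homSymmetry U (-C.1)).1⁆ : smoothFields U).1 q
    rw [bracket_apply _ _ hq, (h _).lieBracket_vectorField_eq (h _), lieBracket_homField,
      homSymmetry_apply U _ hq]
    congr 1
    change -⁅B.1, C.1⁆ = _
    rw [Ring.lie_def]
    noncomm_ring

theorem slHom_bijective (hU : IsConnected (U : Set Config)) :
    Function.Bijective (slHom U) := by
  constructor
  · rw [injective_iff_map_eq_zero]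
    intro B hB
    have h : -B.1 = (-B.1) 2 2 • 1 := eq_smul_one_of_homField_eq_zero hU.nonempty fun q hq => by
      rw [← homSymmetry_apply U _ hq]
      exact congrArg (fun X : symmetryAlgebra velocityDistribution U => X.1.1 q) hB
    have ht : (-B.1).trace = 0 := by
      rw [Matrix.trace_neg, show B.1.trace = 0 from B.2, neg_zero]
    have hc : (-B.1) 2 2 = 0 := by
      rw [h, Matrix.trace_smul, Matrix.trace_one] at ht
      simpa using ht
    rw [hc, zero_smul, neg_eq_zero] at h
    exact Subtype.ext h
  · intro X
    obtain ⟨B, hB⟩ := exists_eq_homField hU X.2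
    -- Subtracting a third of the trace makes the matrix traceless without changing its field.
    have ht : (-(B + (-(B.trace / 3)) • 1)).trace = 0 := by
      rw [Matrix.trace_neg, Matrix.trace_add, Matrix.trace_smul, Matrix.trace_one,
        Fintype.card_fin]
      simp
    refine ⟨⟨-(B + (-(B.trace / 3)) • 1), ht⟩, ?_⟩
    refine Subtype.ext (smoothFields_ext fun q hq => ?_)
    change (homSymmetry U (- -(B + (-(B.trace / 3)) • 1))).1.1 q = _
    rw [homSymmetry_apply U _ hq, neg_neg, homField_add_smul_one, hB q hq]

theorem restrictField_apply (V : Config → Config) (hV : ContDiff ℝ ∞ V) {q : Config}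
    (hq : q ∈ U) : (restrictField U V hV).1 q = V q :=
  Set.indicator_of_mem (s := (U : Set Config)) hq _

theorem sum_smul_restrictField_apply (c : Fin 8 → ℝ) {q : Config} (hq : q ∈ U) :
    (∑ k, c k • restrictField U (projectiveField k) (contDiff_projectiveField k)).1 q =
      homField (coeffMatrix c) q := by
  rw [homField_coeffMatrix, AddSubmonoidClass.coe_finsetSum, Finset.sum_apply]
  refine Finset.sum_congr rfl fun k _ => ?_
  change c k • (restrictField U (projectiveField k) (contDiff_projectiveField k)).1 q = _
  rw [restrictField_apply _ _ hq]

theorem linearIndependent_restrictField (hU : (U : Set Config).Nonempty) :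
    LinearIndependent ℝ fun k : Fin 8 =>
      restrictField U (projectiveField k) (contDiff_projectiveField k) := by
  rw [Fintype.linearIndependent_iff]
  intro c hc
  have h := eq_smul_one_of_homField_eq_zero hU (B := coeffMatrix c) fun q hq => by
    rw [← sum_smul_restrictField_apply c hq, hc]
    rfl
  have e : ∀ k l, coeffMatrix c k l = 0 := by
    intro k l
    rw [h]
    simp [coeffMatrix]
  intro k
  fin_cases k
  · exact e 0 2
  · exact e 1 2
  · exact e 0 1
  · exact e 1 0
  · exact e 0 0
  · exact e 1 1
  · exact neg_eq_zero.1 (e 2 1)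
  · exact neg_eq_zero.1 (e 2 0)

theorem symmetryAlgebra_eq_span (hU : IsConnected (U : Set Config)) :
    (symmetryAlgebra velocityDistribution U).toSubmodule =
      Submodule.span ℝ (Set.range fun k : Fin 8 =>
        restrictField U (projectiveField k) (contDiff_projectiveField k)) := by
  ext X
  rw [Submodule.mem_span_range_iff_exists_fun]
  constructor
  · intro hX
    obtain ⟨B, hB⟩ := exists_eq_homField hU hX
    refine ⟨![B 0 2, B 1 2, B 0 1, B 1 0, B 0 0 - B 2 2, B 1 1 - B 2 2, -B 2 1, -B 2 0],
      smoothFields_ext fun q hq => ?_⟩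
    rw [sum_smul_restrictField_apply _ hq, ← homField_eq_coeffMatrix, hB q hq]
  · rintro ⟨c, rfl⟩
    have h : ∑ k, c k • restrictField U (projectiveField k) (contDiff_projectiveField k) =
        (homSymmetry U (coeffMatrix c)).1 := smoothFields_ext fun q hq => by
      rw [sum_smul_restrictField_apply _ hq, homSymmetry_apply U _ hq]
    rw [h]
    exact (homSymmetry U (coeffMatrix c)).2

end Symmetries

end ThreeAnts

theorem mainTheorem2 :
    (∀ q : ThreeAnts.Config,
      ThreeAnts.HasGrowthVectorAt ThreeAnts.velocityDistribution q [3, 6] ↔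
        ¬ Collinear ℝ (Set.range q)) ∧
    ∀ U : TopologicalSpace.Opens ThreeAnts.Config, IsConnected (U : Set ThreeAnts.Config) →
      Nonempty (ThreeAnts.symmetryAlgebra ThreeAnts.velocityDistribution U ≃ₗ⁅ℝ⁆
        LieAlgebra.SpecialLinear.sl (Fin 3) ℝ) ∧
      Module.finrank ℝ (ThreeAnts.symmetryAlgebra ThreeAnts.velocityDistribution U) = 8 ∧
      LinearIndependent ℝ (fun k : Fin 8 => ThreeAnts.restrictField U
        (ThreeAnts.projectiveField k) (ThreeAnts.contDiff_projectiveField k)) ∧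
      (ThreeAnts.symmetryAlgebra ThreeAnts.velocityDistribution U).toSubmodule =
        Submodule.span ℝ (Set.range fun k : Fin 8 => ThreeAnts.restrictField U
          (ThreeAnts.projectiveField k) (ThreeAnts.contDiff_projectiveField k)) := by
  refine ⟨ThreeAnts.hasGrowthVectorAt_iff, fun U hU => ?_⟩
  have hli := ThreeAnts.linearIndependent_restrictField hU.nonempty
  have hspan := ThreeAnts.symmetryAlgebra_eq_span hU
  refine ⟨⟨(LieEquiv.ofBijective _ (ThreeAnts.slHom_bijective hU)).symm⟩, ?_, hli, hspan⟩
  change Module.finrank ℝ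
    (ThreeAnts.symmetryAlgebra ThreeAnts.velocityDistribution U).toSubmodule = 8
  rw [hspan, finrank_span_eq_card hli, Fintype.card_fin]
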